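/- For a real $m\times n$ matrix $A$ let $s_1(A)\ge s_2(A)\ge\dots$ be its singular values, with $s_i(A)=0$ for $i>\min(m,n)$. For a matrix $M$ of rank $r\ge 1$ let $\kappa(M)=s_1(M)/s_r(M)$ be its condition number and put $$\xi(M)=\frac{M_{\max}\sqrt{\alpha}}{\Sigma_1\sqrt r},\qquad M_{\max}=\max_{i,j}|M_{ij}|,\quad \alpha=\frac{\max(m,n)}{\min(m,n)},\quad \Sigma_1=\frac{s_1(M)}{\sqrt{mn}} .$$ Given a set $E\subseteq[m]\times[n]$ of observed positions, let $\epsilon=|E|/\sqrt{mn}$, and let $\widetilde M^E$ be the trimmed observed matrix: $\widetilde M^E_{ij}=M_{ij}$ if $(i,j)\in E$, row $i$ contains at most $2|E|/m$ and column $j$ at most $2|E|/n$ positions of $E$; otherwise $\widetilde M^E_{ij}=0$. With $\sigma_i=s_i(\widetilde M^E)$ let $$R(i)=\frac{\sigma_{i+1}+\sigma_1\sqrt{i/\epsilon}}{\sigma_i},\qquad 1\le i\le\min(m,n),$$ where $R(i)=\infty$ if $\sigma_i=0<\sigma_1$. Rank Estimation outputs an index $i$ that minimizes $R(i)$. Proposition.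 For all real $\kappa$ and $\xi$ there is a constant $C=C(\kappa,\xi)>0$ with the following property. Let $M$ be an $m\times n$ real matrix of rank $r\ge 1$ with $\kappa(M)\le\kappa$ and $\xi(M)\le\xi$, and let $E$ be uniformly distributed over the subsets of $[m]\times[n]$ of a given size $|E|\le mn$. If $\epsilon=|E|/\sqrt{mn}>C\,r$, then with high probability $r$ is the unique minimizer of $R$, so that Rank Estimation correctly estimates the rank. Here "with high probability" means: for every $\delta>0$ there is an $N$, depending only on $\kappa,\xi,\delta$, such that the probability is at least $1-\delta$ for all such $M$ and $|E|$ with $m,n\ge N$. -/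

import Mathlib

open Finset
open scoped ENNReal

noncomputable section

namespace RankEstimation

variable {m n : ℕ}

/-- The `i`-th largest singular value of `A`, for `i = 1, 2, …`; it is `0` for `i > min m n`. -/
def sv (A : Matrix (Fin m) (Fin n) ℝ) (i : ℕ) : ℝ :=
  (Matrix.toEuclideanLin A).singularValues (i - 1)

/-- The condition number of a nonzero matrix: the ratio of its largest and its smallest nonzero
singular value. -/
def conditionNumber (A : Matrix (Fin m) (Fin n) ℝ) : ℝ :=
  sv A 1 / sv A A.rank

/-- The largest absolute value of an entry. -/
def maxEntry (A : Matrix (Fin m) (Fin n) ℝ) : ℝ :=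
  ⨆ p : Fin m × Fin n, |A p.1 p.2|

/-- The aspect ratio `α ≥ 1` of an `m × n` matrix. -/
def aspectRatio (m n : ℕ) : ℝ :=
  (max m n : ℝ) / (min m n : ℝ)

/-- The parameter `ξ = M_max √α / (Σ₁ √r)`, where `Σ₁` is the largest singular value in the
normalization `Σ_q = sv_q / √(m n)`. -/
def spikeParameter (A : Matrix (Fin m) (Fin n) ℝ) : ℝ :=
  maxEntry A * √(aspectRatio m n) / (sv A 1 / √((m : ℝ) * n) * √(A.rank : ℝ))

/-- The observed matrix: the entries in `E` are kept, the others are set to `0`. -/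
def observed (M : Matrix (Fin m) (Fin n) ℝ) (E : Finset (Fin m × Fin n)) :
    Matrix (Fin m) (Fin n) ℝ :=
  Matrix.of fun i j => if (i, j) ∈ E then M i j else 0

/-- The number of observed entries in row `i`. -/
def rowDegree (E : Finset (Fin m × Fin n)) (i : Fin m) : ℕ := #{p ∈ E | p.1 = i}

/-- The number of observed entries in column `j`. -/
def colDegree (E : Finset (Fin m × Fin n)) (j : Fin n) : ℕ := #{p ∈ E | p.2 = j}

open Classical in
/-- The trimmed observed matrix: rows of degree more than `2|E|/m` and columns of degree more than
`2|E|/n` are set to `0`. -/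
def trimmed (M : Matrix (Fin m) (Fin n) ℝ) (E : Finset (Fin m × Fin n)) :
    Matrix (Fin m) (Fin n) ℝ :=
  Matrix.of fun i j =>
    if (rowDegree E i : ℝ) > 2 * (#E : ℝ) / m ∨ (colDegree E j : ℝ) > 2 * (#E : ℝ) / n then 0
    else observed M E i j

/-- The parameter `ε = |E| / √(m n)`, as a function of the number `s = |E|` of observed entries. -/
def eps (m n s : ℕ) : ℝ := (s : ℝ) / √((m : ℝ) * n)

/-- The cost function `R(i) = (σ_{i+1} + σ₁ √(i/ε)) / σ_i`, where `σ` are the singular values of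
the trimmed observed matrix. The value is `∞` if `σ_i = 0` and the numerator is positive. -/
def cost (M : Matrix (Fin m) (Fin n) ℝ) (E : Finset (Fin m × Fin n)) (i : ℕ) : ℝ≥0∞ :=
  ENNReal.ofReal (sv (trimmed M E) (i + 1) + sv (trimmed M E) 1 * √((i : ℝ) / eps m n #E)) /
    ENNReal.ofReal (sv (trimmed M E) i)

/-- `i` is a possible output of the procedure: it minimizes the cost over `1, …, min m n`. -/
def IsRankEstimate (M : Matrix (Fin m) (Fin n) ℝ) (E : Finset (Fin m × Fin n)) (i : ℕ) : Prop :=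
  i ∈ Icc 1 (min m n) ∧ ∀ j ∈ Icc 1 (min m n), cost M E i ≤ cost M E j

/-- The procedure correctly estimates the rank: the rank of `M` is the one and only minimizer. -/
def EstimatesRank (M : Matrix (Fin m) (Fin n) ℝ) (E : Finset (Fin m × Fin n)) : Prop :=
  ∀ i : ℕ, IsRankEstimate M E i ↔ i = M.rank

open Classical in
/-- The probability of `P E` when `E` is uniformly distributed over all sets of `s` positions. -/
def uniformProb (m n s : ℕ) (P : Finset (Fin m × Fin n) → Prop) : ℝ :=
  (#{E ∈ powersetCard s (univ : Finset (Fin m × Fin n)) | P E} : ℝ) /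
    #(powersetCard s (univ : Finset (Fin m × Fin n)))

end RankEstimation

end

/-! ### Weyl's inequality for singular values -/

namespace LinearMap

variable {E F G : Type*}
  [NormedAddCommGroup E] [InnerProductSpace ℝ E] [FiniteDimensional ℝ E]
  [NormedAddCommGroup F] [InnerProductSpace ℝ F] [FiniteDimensional ℝ F]
  [NormedAddCommGroup G] [InnerProductSpace ℝ G] [FiniteDimensional ℝ G]

/-! Put `p = s/(mn)`, `L = max m n`, `D = √(pL)`, and let `b` be the largest absolute value of an
entry of `M`. Everything rests on one operator norm bound, `uniformProb_norm_trimmed_sub_ge`: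
outside an event of probability at most `6/L`, the trimmed matrix differs from `p • M` by at most `c
= 5330 b D`.

Given this, Weyl's inequality puts every `σ_i` within `c` of `p s_i(M)`. With `W = p s_1(M)` and `g
= √(r/ε)`, the bound on `ξ` turns into `c ≤ a g W`, where `a` depends only on `ξ`. Hence `σ_1` is
comparable to `W`, `σ_r ≥ W/(2κ)` and `σ_{r+1} ≤ a g W`. So `R(r)` is `O(g)`, while `R(j)` is
bounded below by a constant on both sides of `r`: for `j < r` because `σ_{j+1} ≥ σ_r`, and for `j >
r` because the numerator is at least `W g / 2` and the denominator at most `a g W`. Once `g` is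
small, that is, once `ε/r` is large, `r` wins strictly (`estimatesRank_of_norm_sub_le`).

The norm bound follows the method of Friedman, Kahn and Szemerédi and of Feige and Ofek. The
operator norm is tested on a grid of vectors of length at most `√L`, which has `exp(O(L))` points.
For grid vectors `u`, `v`, the pairs with `|u_i v_j| ≤ D` are light and are handled by an
exponential moment and a union bound (`card_light_deviation_le`). The heavy pairs are too large for
this. They are controlled by a discrepancy property of the random set, that no rectangle `A × B`
contains many more positions than expected (`card_discrepancy_le`), combined with a dyadic
decomposition (`sum_balanced_le`) and the degree bounds that trimming enforces (`sum_heavy_le`).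

The fixed size of `E` makes its elements dependent. Comparison with independent sampling costs only
a factor `mn + 1` (`sum_powersetCard_prod_le`), which the tail bounds absorb. -/

theorem norm_sq_apply_eq_sum_singularValues (T : E →ₗ[ℝ] F) {n : ℕ}
    (hn : Module.finrank ℝ E = n) (x : E) :
    ‖T x‖ ^ 2 = ∑ k : Fin n, T.singularValues k ^ 2 *
      (T.isSymmetric_adjoint_comp_self.eigenvectorBasis hn).repr x k ^ 2 := by
  set b := T.isSymmetric_adjoint_comp_self.eigenvectorBasis hn with hb
  have h1 : ‖T x‖ ^ 2 = inner ℝ x ((adjoint T ∘ₗ T) x) := by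
    rw [comp_apply, adjoint_inner_right, real_inner_self_eq_norm_sq]
  rw [h1, ← b.repr.inner_map_map, PiLp.inner_apply]
  refine Finset.sum_congr rfl fun k _ => ?_
  rw [T.isSymmetric_adjoint_comp_self.eigenvectorBasis_apply_self_apply hn,
    T.sq_singularValues_fin hn]
  simp
  ring

/-- A form of Weyl's inequality for singular values. -/
theorem singularValues_le_of_norm_le (T : E →ₗ[ℝ] F) (S : E →ₗ[ℝ] G) {p c : ℝ}
    (hp : 0 ≤ p) (hc : 0 ≤ c) (h : ∀ x, ‖T x‖ ≤ p * ‖S x‖ + c * ‖x‖) (i : ℕ) :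
    T.singularValues i ≤ p * S.singularValues i + c := by
  by_cases! hi : Module.finrank ℝ E ≤ i
  · rw [T.singularValues_of_finrank_le hi, S.singularValues_of_finrank_le hi]
    simpa using hc
  obtain ⟨n, hn⟩ : ∃ n, Module.finrank ℝ E = n := ⟨_, rfl⟩
  set v := T.isSymmetric_adjoint_comp_self.eigenvectorBasis hn with hv
  set w := S.isSymmetric_adjoint_comp_self.eigenvectorBasis hn with hw
  rw [hn] at hi
  -- The kernel is the set of vectors in the span of the first `i + 1` right singular vectors of `T`
  -- that are orthogonal to the first `i` of `S`. There are `(n - 1 - i) + i = n - 1` conditions, so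
  -- it is nonzero. On it `T` stretches by at least its singular value `i`, and `S` by at most its
  -- own.
  let f : E →ₗ[ℝ] ({k : Fin n // i < k} → ℝ) × ({k : Fin n // (k : ℕ) < i} → ℝ) :=
    (LinearMap.pi fun k : {k : Fin n // i < k} => v.toBasis.coord k.1).prod
      (LinearMap.pi fun k : {k : Fin n // (k : ℕ) < i} => w.toBasis.coord k.1)
  have hf : ker f ≠ ⊥ := by
    apply ker_ne_bot_of_finrank_lt
    rw [Module.finrank_prod, Module.finrank_fintype_fun_eq_card,
      Module.finrank_fintype_fun_eq_card, hn]
    have h1 : Fintype.card {k : Fin n // i < k} = n - 1 - i := by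
      have := Fin.card_Ioi (⟨i, hi⟩ : Fin n)
      rw [← this, Fintype.card_subtype]
      congr 1
      ext k; simp [Fin.lt_def]
    have h2 : Fintype.card {k : Fin n // (k : ℕ) < i} = i := by
      have := Fin.card_Iio (⟨i, hi⟩ : Fin n)
      conv_rhs => rw [show i = ((⟨i, hi⟩ : Fin n) : ℕ) from rfl, ← this]
      rw [Fintype.card_subtype]
      congr 1
      ext k; simp [Fin.lt_def]
    rw [h1, h2]; lia
  obtain ⟨x, hx, hx0⟩ := Submodule.exists_mem_ne_zero_of_ne_bot hf
  have hxv : ∀ k : Fin n, i < k → v.repr x k = 0 := fun k hk => by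
    simpa [f] using congrFun (congrArg Prod.fst (LinearMap.mem_ker.mp hx)) ⟨k, hk⟩
  have hxw : ∀ k : Fin n, (k : ℕ) < i → w.repr x k = 0 := fun k hk => by
    simpa [f] using congrFun (congrArg Prod.snd (LinearMap.mem_ker.mp hx)) ⟨k, hk⟩
  have hnorm : ∀ b : OrthonormalBasis (Fin n) ℝ E, ‖x‖ ^ 2 = ∑ k, b.repr x k ^ 2 := fun b => by
    rw [← b.repr.norm_map, EuclideanSpace.norm_sq_eq]
    simp
  have hT : T.singularValues i * ‖x‖ ≤ ‖T x‖ := by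
    refine le_of_sq_le_sq ?_ (norm_nonneg _)
    rw [mul_pow, hnorm v, T.norm_sq_apply_eq_sum_singularValues hn, Finset.mul_sum]
    refine Finset.sum_le_sum fun k _ => ?_
    rcases lt_or_ge i (k : ℕ) with hk | hk
    · rw [← hv, hxv k hk]; simp
    · exact mul_le_mul_of_nonneg_right (pow_le_pow_left₀ (T.singularValues_nonneg _)
        (T.singularValues_antitone hk) 2) (sq_nonneg _)
  have hS : ‖S x‖ ≤ S.singularValues i * ‖x‖ := by
    refine le_of_sq_le_sq ?_ (mul_nonneg (S.singularValues_nonneg _) (norm_nonneg _))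
    rw [mul_pow, hnorm w, S.norm_sq_apply_eq_sum_singularValues hn, Finset.mul_sum]
    refine Finset.sum_le_sum fun k _ => ?_
    rcases lt_or_ge (k : ℕ) i with hk | hk
    · rw [← hw, hxw k hk]; simp
    · exact mul_le_mul_of_nonneg_right (pow_le_pow_left₀ (S.singularValues_nonneg _)
        (S.singularValues_antitone hk) 2) (sq_nonneg _)
  have hpos : 0 < ‖x‖ := norm_pos_iff.mpr hx0
  have := mul_le_mul_of_nonneg_left hS hp
  refine le_of_mul_le_mul_right ?_ hpos
  linarith [h x]

end LinearMap

/-! ### Singular values of matrices -/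

namespace RankEstimation

variable {m n : ℕ}

theorem sv_nonneg (A : Matrix (Fin m) (Fin n) ℝ) (i : ℕ) : 0 ≤ sv A i :=
  LinearMap.singularValues_nonneg _ _

theorem sv_anti (A : Matrix (Fin m) (Fin n) ℝ) {i j : ℕ} (h : i ≤ j) : sv A j ≤ sv A i :=
  LinearMap.singularValues_antitone _ (by lia)

theorem finrank_range_toEuclideanLin (A : Matrix (Fin m) (Fin n) ℝ) :
    Module.finrank ℝ (Matrix.toEuclideanLin A).range = A.rank := by
  rw [Matrix.toEuclideanLin_eq_toLin_orthonormal, ← Matrix.rank_eq_finrank_range_toLin]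

theorem sv_pos {A : Matrix (Fin m) (Fin n) ℝ} {i : ℕ} (hi : 1 ≤ i) (h : i ≤ A.rank) :
    0 < sv A i := by
  rw [sv, LinearMap.singularValues_pos_iff_lt_finrank_range, finrank_range_toEuclideanLin]
  lia

theorem sv_rank_add_one (A : Matrix (Fin m) (Fin n) ℝ) : sv A (A.rank + 1) = 0 := by
  rw [sv, LinearMap.singularValues_eq_zero_iff_le_finrank_range, finrank_range_toEuclideanLin]
  lia

theorem sv_le_of_norm_le (A B : Matrix (Fin m) (Fin n) ℝ) {p c : ℝ} (hp : 0 ≤ p) (hc : 0 ≤ c)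
    (h : ∀ x, ‖Matrix.toEuclideanLin A x‖ ≤ p * ‖Matrix.toEuclideanLin B x‖ + c * ‖x‖) (i : ℕ) :
    sv A i ≤ p * sv B i + c :=
  LinearMap.singularValues_le_of_norm_le _ _ hp hc h _

end RankEstimation

/-! ### Exponential moments for sampling without replacement -/

namespace RankEstimation

/-- The ratio of consecutive weights is `(N - k) s / ((k + 1) (N - s))`, written without division.
It is at least `1` for `k < s` and at most `1` for `k ≥ s`. -/
theorem binomial_weight_succ {N s k : ℕ} (hk : k < N) :
    (k + 1) * (N.choose (k + 1) * s ^ (k + 1) * (N - s) ^ (N - (k + 1)) * (N - s)) =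
      N.choose k * s ^ k * (N - s) ^ (N - k) * ((N - k) * s) := by
  have h1 := Nat.choose_succ_right_eq N k
  have h2 : (N - s) ^ (N - k) = (N - s) ^ (N - (k + 1)) * (N - s) := by
    rw [← pow_succ]; congr 1; lia
  rw [h2, pow_succ]
  calc _ = (N.choose (k + 1) * (k + 1)) * (s ^ k * s * (N - s) ^ (N - (k + 1)) * (N - s)) := by
        ring
    _ = _ := by rw [h1]; ring

/-- The weights of the binomial distribution with mean `s` are maximal at `s`. -/
theorem binomial_weight_le_mode {N s k : ℕ} (hs : s ≤ N) (hk : k ≤ N) :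
    N.choose k * s ^ k * (N - s) ^ (N - k) ≤ N.choose s * s ^ s * (N - s) ^ (N - s) := by
  rcases hs.eq_or_lt with rfl | hsN
  · rcases hk.eq_or_lt with rfl | hk
    · exact le_rfl
    · simp [Nat.sub_ne_zero_of_lt hk]
  have hpos : 0 < N - s := by lia
  rcases le_total k s with h | h
  · induction h using Nat.decreasingInduction with
    | self => exact le_rfl
    | of_succ j hj ih =>
      refine le_trans ?_ (ih (by lia))
      have h := binomial_weight_succ (s := s) (show j < N by lia)
      have h3 : (j + 1) * (N - s) ≤ (N - j) * s := by
        rw [mul_comm]; exact Nat.mul_le_mul (by lia) (by lia)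
      refine Nat.le_of_mul_le_mul_right ?_ (Nat.mul_pos (show 0 < j + 1 by lia) hpos)
      calc _ ≤ N.choose j * s ^ j * (N - s) ^ (N - j) * ((N - j) * s) :=
            Nat.mul_le_mul_left _ h3
        _ = _ := by rw [← h]; ring
  · induction k, h using Nat.le_induction with
    | base => exact le_rfl
    | succ j hj ih =>
      refine le_trans ?_ (ih (by lia))
      have h := binomial_weight_succ (s := s) (show j < N by lia)
      have h3 : (N - j) * s ≤ (j + 1) * (N - s) := by
        rw [mul_comm]; exact Nat.mul_le_mul (by lia) (by lia)
      refine Nat.le_of_mul_le_mul_right ?_ (Nat.mul_pos (show 0 < j + 1 by lia) hpos)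
      calc _ = N.choose j * s ^ j * (N - s) ^ (N - j) * ((N - j) * s) := by rw [← h]; ring
        _ ≤ _ := Nat.mul_le_mul_left _ h3

/-- The `N + 1` weights add up to `N ^ N`, and the one at `s` is the largest. Thus independent
sampling at density `s/N` hits size exactly `s` with probability at least `1/(N + 1)`. -/
theorem pow_le_binomial_weight {N s : ℕ} (hs : s ≤ N) :
    N ^ N ≤ (N + 1) * (N.choose s * s ^ s * (N - s) ^ (N - s)) := by
  calc N ^ N = (s + (N - s)) ^ N := by rw [Nat.add_sub_cancel' hs]
    _ = ∑ k ∈ range (N + 1), N.choose k * s ^ k * (N - s) ^ (N - k) := by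
        rw [add_pow]
        exact Finset.sum_congr rfl fun k _ => by push_cast; ring
    _ ≤ ∑ k ∈ range (N + 1), N.choose s * s ^ s * (N - s) ^ (N - s) :=
        Finset.sum_le_sum fun k hk => binomial_weight_le_mode hs (by
          have := Finset.mem_range.mp hk; lia)
    _ = _ := by simp

variable {ι : Type*} [Fintype ι] [DecidableEq ι]

/-- Sampling `s` elements without replacement, compared with independent sampling at the same
density. -/
theorem sum_powersetCard_prod_le {s : ℕ} (hs : s ≤ Fintype.card ι) (a : ι → ℝ)
    (ha : ∀ e, 0 ≤ a e) :
    ∑ E ∈ powersetCard s (univ : Finset ι), ∏ e ∈ E, a e ≤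
      (Fintype.card ι + 1) * #(powersetCard s (univ : Finset ι)) *
        ∏ e, (1 + (s : ℝ) / Fintype.card ι * (a e - 1)) := by
  set N := Fintype.card ι with hN
  have hw : (0 : ℝ) < (s : ℝ) ^ s * ((N - s : ℕ) : ℝ) ^ (N - s) := by
    have : 0 < s ^ s * (N - s) ^ (N - s) :=
      Nat.mul_pos Nat.pow_self_pos Nat.pow_self_pos
    exact_mod_cast this
  have h1 : (∑ E ∈ powersetCard s (univ : Finset ι), ∏ e ∈ E, a e) *
      ((s : ℝ) ^ s * ((N - s : ℕ) : ℝ) ^ (N - s)) ≤ ∏ e, (s * a e + ((N - s : ℕ) : ℝ)) := by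
    -- The product expands into a sum over all subsets; only those of size `s` are kept, the other
    -- terms being nonnegative.
    rw [Finset.prod_add, Finset.sum_mul]
    refine (Finset.sum_le_sum fun E hE => ?_).trans (Finset.sum_le_sum_of_subset_of_nonneg
      (s := powersetCard s (univ : Finset ι)) (by simp) fun E _ _ => ?_)
    · have hc := (mem_powersetCard.mp hE).2
      rw [Finset.prod_const, Finset.prod_mul_distrib, Finset.prod_const,
        Finset.card_sdiff_of_subset (subset_univ _), hc, card_univ, ← hN]
      exact le_of_eq (by ring)
    · exact mul_nonneg (Finset.prod_nonneg fun e _ => mul_nonneg (Nat.cast_nonneg _) (ha e))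
        (Finset.prod_nonneg fun e _ => Nat.cast_nonneg _)
  rcases Nat.eq_zero_or_pos N with h0 | h0
  · have : IsEmpty ι := Fintype.card_eq_zero_iff.mp h0
    have hs0 : s = 0 := by lia
    subst hs0
    simp [h0]
  have hN0 : (N : ℝ) ≠ 0 := by positivity
  have h2 : ∏ e, (s * a e + ((N - s : ℕ) : ℝ)) =
      (N : ℝ) ^ N * ∏ e, (1 + (s : ℝ) / N * (a e - 1)) := by
    rw [hN, ← card_univ, ← Finset.prod_const, ← Finset.prod_mul_distrib, card_univ, ← hN]
    refine Finset.prod_congr rfl fun e _ => ?_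
    rw [Nat.cast_sub hs]; field_simp; ring
  have h3 : (N : ℝ) ^ N ≤ (N + 1) * #(powersetCard s (univ : Finset ι)) *
      ((s : ℝ) ^ s * ((N - s : ℕ) : ℝ) ^ (N - s)) := by
    rw [card_powersetCard, card_univ, ← hN]
    have := pow_le_binomial_weight hs
    calc (N : ℝ) ^ N ≤ ((N + 1) * (N.choose s * s ^ s * (N - s) ^ (N - s)) : ℕ) := by
          exact_mod_cast this
      _ = _ := by push_cast; ring
  have h4 : 0 ≤ ∏ e, (1 + (s : ℝ) / N * (a e - 1)) := by
    refine Finset.prod_nonneg fun e _ => ?_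
    have h5 : (s : ℝ) / N ≤ 1 := div_le_one_of_le₀ (by exact_mod_cast hs) (by positivity)
    have h6 : 0 ≤ (s : ℝ) / N * a e := mul_nonneg (by positivity) (ha e)
    linarith
  refine le_of_mul_le_mul_right ?_ hw
  calc _ ≤ _ := h1
    _ = _ := h2
    _ ≤ _ := mul_le_mul_of_nonneg_right h3 h4
    _ = _ := by ring

/-- The exponential Markov inequality for a linear statistic of a uniform `s`-element set. -/
theorem card_le_sum_le_exp {s : ℕ} (hs : s ≤ Fintype.card ι) (f : ι → ℝ) (T : ℝ) :
    (#{E ∈ powersetCard s (univ : Finset ι) | T ≤ ∑ e ∈ E, f e} : ℝ) ≤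
      (Fintype.card ι + 1) * #(powersetCard s (univ : Finset ι)) *
        Real.exp ((s : ℝ) / Fintype.card ι * ∑ e, (Real.exp (f e) - 1) - T) := by
  have hp : (s : ℝ) / Fintype.card ι ≤ 1 :=
    div_le_one_of_le₀ (by exact_mod_cast hs) (by positivity)
  have h := sum_powersetCard_prod_le hs (fun e => Real.exp (f e)) fun e => (Real.exp_pos _).le
  have h1 : (#{E ∈ powersetCard s (univ : Finset ι) | T ≤ ∑ e ∈ E, f e} : ℝ) * Real.exp T ≤
      ∑ E ∈ powersetCard s (univ : Finset ι), ∏ e ∈ E, Real.exp (f e) := by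
    rw [← nsmul_eq_mul, ← Finset.sum_const]
    refine (Finset.sum_le_sum fun E hE => ?_).trans
      (Finset.sum_le_sum_of_subset_of_nonneg (filter_subset _ _) fun E _ _ =>
        Finset.prod_nonneg fun e _ => (Real.exp_pos _).le)
    rw [← Real.exp_sum]
    exact Real.exp_le_exp.mpr (mem_filter.mp hE).2
  have h2 : ∏ e, (1 + (s : ℝ) / Fintype.card ι * (Real.exp (f e) - 1)) ≤
      Real.exp ((s : ℝ) / Fintype.card ι * ∑ e, (Real.exp (f e) - 1)) := by
    rw [Finset.mul_sum, Real.exp_sum]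
    refine Finset.prod_le_prod (fun e _ => ?_) fun e _ => ?_
    · have : 0 ≤ (s : ℝ) / Fintype.card ι * Real.exp (f e) := by positivity
      linarith
    · linarith [Real.add_one_le_exp ((s : ℝ) / Fintype.card ι * (Real.exp (f e) - 1))]
  refine le_of_mul_le_mul_right ?_ (Real.exp_pos T)
  rw [mul_assoc, ← Real.exp_add, sub_add_cancel]
  exact (h1.trans h).trans (mul_le_mul_of_nonneg_left h2 (by positivity))

end RankEstimation

/-! ### The grid and the light pairs -/

namespace RankEstimation

theorem card_filter_exists_le {α β : Type*} (Ω : Finset α) (S : Finset β) (P : β → α → Prop)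
    [DecidablePred fun E => ∃ x ∈ S, P x E] [∀ x, DecidablePred (P x)] {c : β → ℝ}
    (h : ∀ x ∈ S, (#{E ∈ Ω | P x E} : ℝ) ≤ c x) :
    (#{E ∈ Ω | ∃ x ∈ S, P x E} : ℝ) ≤ ∑ x ∈ S, c x := by
  classical
  refine le_trans ?_ (Finset.sum_le_sum h)
  rw [← Nat.cast_sum, Nat.cast_le]
  refine (Finset.card_le_card fun E hE => ?_).trans
    (Finset.card_biUnion_le (s := S) (t := fun x => {E ∈ Ω | P x E}))
  obtain ⟨hE, x, hx, hxE⟩ := Finset.mem_filter.mp hE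
  exact Finset.mem_biUnion.mpr ⟨x, hx, Finset.mem_filter.mpr ⟨hE, hxE⟩⟩

/-- The vectors with entries in `ℤ / 4` whose squared length is at most `L`. -/
noncomputable def quarterGrid (m L : ℕ) : Finset (Fin m → ℝ) :=
  ({z ∈ Fintype.piFinset fun _ : Fin m => Icc (-(16 * L : ℤ)) (16 * L) |
    ∑ i, z i ^ 2 ≤ 16 * (L : ℤ)}).image fun z i => (z i : ℝ) / 4

/-- The box in the definition serves only finiteness: integers satisfy `|z| ≤ z²`, so the quadratic
constraint already implies `|z i| ≤ 16L`. -/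
theorem mem_quarterGrid {m L : ℕ} {u : Fin m → ℝ} :
    u ∈ quarterGrid m L ↔ (∀ i, ∃ z : ℤ, u i = z / 4) ∧ ∑ i, u i ^ 2 ≤ (L : ℝ) := by
  have key : ∀ z : Fin m → ℤ, (∑ i, ((z i : ℝ) / 4) ^ 2 ≤ (L : ℝ)) ↔
      ∑ i, z i ^ 2 ≤ 16 * (L : ℤ) := by
    intro z
    have : ∑ i, ((z i : ℝ) / 4) ^ 2 = ((∑ i, z i ^ 2 : ℤ) : ℝ) / 16 := by
      push_cast
      rw [Finset.sum_div]
      exact Finset.sum_congr rfl fun i _ => by ring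
    rw [this, div_le_iff₀ (by norm_num), mul_comm (L : ℝ)]
    exact_mod_cast Iff.rfl
  rw [quarterGrid, mem_image]
  constructor
  · rintro ⟨z, hz, rfl⟩
    exact ⟨fun i => ⟨z i, rfl⟩, (key z).mpr (mem_filter.mp hz).2⟩
  · rintro ⟨hu, hL⟩
    choose z hz using hu
    have hu : u = fun i => (z i : ℝ) / 4 := funext hz
    subst hu
    refine ⟨z, mem_filter.mpr ⟨Fintype.mem_piFinset.mpr fun i => ?_, (key z).mp hL⟩, rfl⟩
    have h1 : z i ^ 2 ≤ 16 * L := (Finset.single_le_sum (f := fun i => z i ^ 2)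
      (fun i _ => sq_nonneg _) (mem_univ i)).trans ((key z).mp hL)
    have h2 : |z i| ≤ z i ^ 2 := by
      rw [← sq_abs]; rcases (abs_nonneg (z i)).eq_or_lt with h | h
      · rw [← h]; norm_num
      · nlinarith
    exact mem_Icc.mpr (abs_le.mp (h2.trans h1))

theorem sum_Icc_exp_neg_sq_le (R : ℕ) :
    ∑ z ∈ Icc (-(R : ℤ)) R, Real.exp (-(z : ℝ) ^ 2) ≤ 4 := by
  have hsub : Icc (-(R : ℤ)) R ⊆ (range (R + 1)).image (fun k : ℕ => (k : ℤ)) ∪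
      (range (R + 1)).image (fun k : ℕ => -(k : ℤ)) := by
    intro z hz
    have := mem_Icc.mp hz
    simp only [mem_union, mem_image, mem_range]
    rcases le_total 0 z with h | h
    · exact Or.inl ⟨z.natAbs, by lia, by lia⟩
    · exact Or.inr ⟨z.natAbs, by lia, by lia⟩
  have hg : ∑ k ∈ range (R + 1), Real.exp (-(k : ℝ) ^ 2) ≤ 2 := by
    refine (Finset.sum_le_sum fun k _ => ?_).trans (sum_geometric_two_le (R + 1))
    have h1 : Real.exp (-1) ≤ 1 / 2 := by
      rw [Real.exp_neg, inv_le_comm₀ (Real.exp_pos _) (by norm_num)]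
      have := Real.add_one_le_exp (1 : ℝ)
      norm_num at this ⊢; exact this
    have h2 : (k : ℝ) ≤ (k : ℝ) ^ 2 := by
      have : k ≤ k ^ 2 := Nat.le_self_pow (by norm_num) k
      exact_mod_cast this
    calc Real.exp (-(k : ℝ) ^ 2) ≤ Real.exp (k * (-1)) := Real.exp_le_exp.mpr (by linarith)
      _ = Real.exp (-1) ^ k := Real.exp_nat_mul _ _
      _ ≤ _ := pow_le_pow_left₀ (Real.exp_pos _).le h1 k
  refine (Finset.sum_le_sum_of_subset_of_nonneg hsub fun _ _ _ => (Real.exp_pos _).le).trans ?_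
  have h := Finset.sum_union_inter (s₁ := (range (R + 1)).image (fun k : ℕ => (k : ℤ)))
    (s₂ := (range (R + 1)).image (fun k : ℕ => -(k : ℤ))) (f := fun z => Real.exp (-(z : ℝ) ^ 2))
  rw [Finset.sum_image (by intro a _ b _ h; simpa using h),
    Finset.sum_image (by intro a _ b _ h; simpa using h)] at h
  have h0 : 0 ≤ ∑ z ∈ (range (R + 1)).image (fun k : ℕ => (k : ℤ)) ∩
      (range (R + 1)).image (fun k : ℕ => -(k : ℤ)), Real.exp (-(z : ℝ) ^ 2) :=
    Finset.sum_nonneg fun _ _ => (Real.exp_pos _).le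
  simp only [Int.cast_neg, Int.cast_natCast, neg_sq] at h
  linarith

/-- An exponential Markov bound on lattice points: each point of the ball has Gaussian weight at
least `exp(-16L)`, and the total weight factors over coordinates into at most `4^m ≤ exp(2L)`. -/
theorem card_quarterGrid_le {m L : ℕ} (hm : m ≤ L) :
    (#(quarterGrid m L) : ℝ) ≤ Real.exp (18 * L) := by
  set P := Fintype.piFinset fun _ : Fin m => Icc (-(16 * L : ℤ)) (16 * L) with hP
  have h1 : (#(quarterGrid m L) : ℝ) ≤ #{z ∈ P | ∑ i, z i ^ 2 ≤ 16 * (L : ℤ)} := by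
    rw [Nat.cast_le, quarterGrid]
    exact card_image_le
  have h2 : (#{z ∈ P | ∑ i, z i ^ 2 ≤ 16 * (L : ℤ)} : ℝ) * Real.exp (-(16 * L)) ≤
      ∑ z ∈ P, ∏ i, Real.exp (-(z i : ℝ) ^ 2) := by
    rw [← nsmul_eq_mul, ← Finset.sum_const]
    refine (Finset.sum_le_sum fun z hz => ?_).trans
      (Finset.sum_le_sum_of_subset_of_nonneg (filter_subset _ _) fun z _ _ =>
        Finset.prod_nonneg fun e _ => (Real.exp_pos _).le)
    rw [← Real.exp_sum, Finset.sum_neg_distrib]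
    have : ∑ i, (z i : ℝ) ^ 2 ≤ 16 * L := by exact_mod_cast (mem_filter.mp hz).2
    exact Real.exp_le_exp.mpr (by linarith)
  have h3 : ∑ z ∈ P, ∏ i, Real.exp (-(z i : ℝ) ^ 2) ≤ 4 ^ m := by
    rw [hP, ← Finset.prod_univ_sum (fun _ : Fin m => Icc (-(16 * L : ℤ)) (16 * L))
      (fun _ z => Real.exp (-(z : ℝ) ^ 2)), Finset.prod_const, card_univ, Fintype.card_fin]
    refine pow_le_pow_left₀ (Finset.sum_nonneg fun _ _ => (Real.exp_pos _).le) ?_ m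
    exact_mod_cast sum_Icc_exp_neg_sq_le (16 * L)
  have h4 : (4 : ℝ) ^ m ≤ Real.exp (2 * L) := by
    have h5 : (4 : ℝ) ≤ Real.exp 2 := by
      have h6 := Real.add_one_le_exp (1 : ℝ)
      have h7 : Real.exp 2 = Real.exp 1 * Real.exp 1 := by rw [← Real.exp_add]; norm_num
      nlinarith
    calc (4 : ℝ) ^ m ≤ 4 ^ L := pow_le_pow_right₀ (by norm_num) hm
      _ ≤ Real.exp 2 ^ L := pow_le_pow_left₀ (by norm_num) h5 L
      _ = _ := by rw [← Real.exp_nat_mul]; ring_nf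
  refine h1.trans (le_of_mul_le_mul_right ?_ (Real.exp_pos (-(16 * L))))
  rw [← Real.exp_add]
  refine (h2.trans h3).trans (h4.trans (Real.exp_le_exp.mpr (by linarith)))

/-- An upper tail bound of Bernstein type for a bounded statistic. -/
theorem card_deviation_le {ι : Type*} [Fintype ι] [DecidableEq ι] {s : ℕ}
    (hs : s ≤ Fintype.card ι) (g : ι → ℝ) {V T : ℝ} (hg : ∀ e, |g e| ≤ 1)
    (hV : (s : ℝ) / Fintype.card ι * ∑ e, g e ^ 2 ≤ V) :
    (#{E ∈ powersetCard s (univ : Finset ι) |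
      (s : ℝ) / Fintype.card ι * ∑ e, g e + T ≤ ∑ e ∈ E, g e} : ℝ) ≤
      (Fintype.card ι + 1) * #(powersetCard s (univ : Finset ι)) * Real.exp (V - T) := by
  refine (card_le_sum_le_exp hs g _).trans
    (mul_le_mul_of_nonneg_left (Real.exp_le_exp.mpr ?_) (by positivity))
  -- This is `exp x ≤ 1 + x + x²` for `|x| ≤ 1`.
  have h : ∑ e, (Real.exp (g e) - 1) ≤ ∑ e, g e + ∑ e, g e ^ 2 := by
    rw [← Finset.sum_add_distrib]
    refine Finset.sum_le_sum fun e _ => ?_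
    linarith [le_of_abs_le (Real.abs_exp_sub_one_sub_id_le (hg e))]
  have h2 := mul_le_mul_of_nonneg_left h
    (show 0 ≤ (s : ℝ) / Fintype.card ι by positivity)
  rw [mul_add] at h2
  linarith

variable {m n : ℕ}

/-- The positions where the rank one matrix `u vᵀ` has entries of size at most `c`. -/
noncomputable def lightPairs (u : Fin m → ℝ) (v : Fin n → ℝ) (c : ℝ) : Finset (Fin m × Fin n) :=
  {e | |u e.1 * v e.2| ≤ c}

theorem sum_prod_sq {u : Fin m → ℝ} {v : Fin n → ℝ} :
    ∑ e : Fin m × Fin n, (u e.1 * v e.2) ^ 2 = (∑ i, u i ^ 2) * ∑ j, v j ^ 2 := by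
  rw [Fintype.sum_prod_type, Finset.sum_mul_sum]
  exact Finset.sum_congr rfl fun i _ => Finset.sum_congr rfl fun j _ => mul_pow _ _ _

/-- With high probability the light pairs contribute little to the bilinear form of the centered
observed matrix, uniformly over the grid. -/
theorem card_light_deviation_le {s L : ℕ} (hs : s ≤ m * n) (hmL : m ≤ L) (hnL : n ≤ L)
    (hL : 0 < L) {p d : ℝ} (hp : p = (s : ℝ) / (m * n)) (hd : d = p * L) (hd0 : 0 < d)
    (M : Matrix (Fin m) (Fin n) ℝ) (hM : ∀ i j, |M i j| ≤ 1)
    [DecidablePred fun E : Finset (Fin m × Fin n) =>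
      ∃ w ∈ quarterGrid m L ×ˢ quarterGrid n L,
      p * ∑ e ∈ lightPairs w.1 w.2 √d, w.1 e.1 * w.2 e.2 * M e.1 e.2 + 40 * L * √d ≤
        ∑ e ∈ E with e ∈ lightPairs w.1 w.2 √d, w.1 e.1 * w.2 e.2 * M e.1 e.2] :
    (#{E ∈ powersetCard s (univ : Finset (Fin m × Fin n)) |
      ∃ w ∈ quarterGrid m L ×ˢ quarterGrid n L,
      p * ∑ e ∈ lightPairs w.1 w.2 √d, w.1 e.1 * w.2 e.2 * M e.1 e.2 + 40 * L * √d ≤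
        ∑ e ∈ E with e ∈ lightPairs w.1 w.2 √d, w.1 e.1 * w.2 e.2 * M e.1 e.2} : ℝ) ≤
      (L ^ 2 + 1) * Real.exp (-(3 * L)) * #(powersetCard s (univ : Finset (Fin m × Fin n))) := by
  classical
  have hsq : 0 < √d := Real.sqrt_pos.mpr hd0
  have hcard : Fintype.card (Fin m × Fin n) = m * n := by simp
  have hp' : (s : ℝ) / Fintype.card (Fin m × Fin n) = p := by rw [hp, hcard]; push_cast; rfl
  have hp0 : 0 ≤ p := by rw [hp]; positivity
  set Ω := powersetCard s (univ : Finset (Fin m × Fin n)) with hΩ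
  have hmn : ((Fintype.card (Fin m × Fin n) : ℕ) : ℝ) ≤ (L : ℝ) ^ 2 := by
    rw [hcard, sq]; exact_mod_cast Nat.mul_le_mul hmL hnL
  -- After division by `√d` the light terms are at most `1` in size and their variance proxy is `p
  -- L²/d = L`. The deviation `40L` therefore gives `exp(-39L)`, which beats the `exp(36L)` pairs of
  -- grid vectors.
  refine (card_filter_exists_le Ω _ _
    (c := fun _ => (L ^ 2 + 1) * #Ω * Real.exp (L - 40 * L)) fun w hw => ?_).trans ?_
  · obtain ⟨u, v⟩ := w
    obtain ⟨hu, hv⟩ := mem_product.mp hw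
    have hu2 := (mem_quarterGrid.mp hu).2
    have hv2 := (mem_quarterGrid.mp hv).2
    set g : Fin m × Fin n → ℝ := fun e =>
      if e ∈ lightPairs u v √d then u e.1 * v e.2 * M e.1 e.2 / √d else 0 with hg
    have hg1 : ∀ e, |g e| ≤ 1 := by
      intro e
      simp only [hg]
      split_ifs with h
      · rw [lightPairs, mem_filter] at h
        rw [abs_div, abs_mul, abs_of_pos hsq, div_le_one hsq]
        calc _ ≤ |u e.1 * v e.2| * 1 := mul_le_mul_of_nonneg_left (hM _ _) (abs_nonneg _)
          _ ≤ √d := by rw [mul_one]; exact h.2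
      · simp
    have hg2 : ∑ e, g e ^ 2 ≤ (L : ℝ) ^ 2 / d := by
      calc ∑ e, g e ^ 2 ≤ ∑ e : Fin m × Fin n, (u e.1 * v e.2) ^ 2 / d := by
            refine Finset.sum_le_sum fun e _ => ?_
            simp only [hg]
            split_ifs with h
            · rw [div_pow, Real.sq_sqrt hd0.le, mul_pow _ (M e.1 e.2)]
              have : M e.1 e.2 ^ 2 ≤ 1 := by
                rw [← sq_abs]; exact pow_le_one₀ (abs_nonneg _) (hM _ _)
              gcongr
              exact mul_le_of_le_one_right (sq_nonneg _) this
            · simp; positivity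
        _ ≤ (L : ℝ) ^ 2 / d := by
            rw [← Finset.sum_div, sum_prod_sq, sq]
            gcongr
    have hV : (s : ℝ) / Fintype.card (Fin m × Fin n) * ∑ e, g e ^ 2 ≤ L := by
      rw [hp']
      calc p * ∑ e, g e ^ 2 ≤ p * ((L : ℝ) ^ 2 / d) := mul_le_mul_of_nonneg_left hg2 hp0
        _ = L := by
          rw [hd] at hd0 ⊢
          have : p ≠ 0 := by rintro rfl; simp at hd0
          field_simp
    have h := card_deviation_le (T := 40 * L) (by rw [hcard]; exact hs) g hg1 hV
    refine le_trans ?_ (h.trans (by gcongr))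
    rw [Nat.cast_le]
    refine card_le_card fun E hE => ?_
    rw [mem_filter] at hE ⊢
    refine ⟨hE.1, ?_⟩
    have h1 : ∑ e, g e = (∑ e ∈ lightPairs u v √d, u e.1 * v e.2 * M e.1 e.2) / √d := by
      simp only [hg]
      rw [← Finset.sum_filter, Finset.sum_div]
      exact Finset.sum_congr (by ext; simp) fun _ _ => rfl
    have h2 : ∑ e ∈ E, g e =
        (∑ e ∈ E with e ∈ lightPairs u v √d, u e.1 * v e.2 * M e.1 e.2) / √d := by
      simp only [hg]
      rw [← Finset.sum_filter, Finset.sum_div]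
    rw [hp', h1, h2, le_div_iff₀ hsq, add_mul, mul_assoc, div_mul_cancel₀ _ hsq.ne']
    exact hE.2
  · rw [Finset.sum_const, nsmul_eq_mul, card_product]
    push_cast
    have h1 := card_quarterGrid_le hmL
    have h2 := card_quarterGrid_le hnL
    calc _ ≤ Real.exp (18 * L) * Real.exp (18 * L) *
          (((L : ℝ) ^ 2 + 1) * #Ω * Real.exp (L - 40 * L)) := by gcongr
      _ = (L ^ 2 + 1) * (Real.exp (18 * L) * Real.exp (18 * L) * Real.exp (L - 40 * L)) * #Ω := by
          ring
      _ = _ := by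
          rw [← Real.exp_add, ← Real.exp_add]
          congr 3
          ring

end RankEstimation

/-! ### Subset entropy and the discrepancy property -/

namespace RankEstimation

/-- An upper bound for the logarithm of the number of `a`-element subsets of an `L`-element set. -/
noncomputable def subsetEntropy (L a : ℕ) : ℝ := a * (1 + Real.log ((L : ℝ) / a))

theorem choose_le_exp_subsetEntropy {m L a : ℕ} (hm : m ≤ L) (ha : 1 ≤ a) (haL : a ≤ L) :
    (m.choose a : ℝ) ≤ Real.exp (subsetEntropy L a) := by
  have ha0 : (0 : ℝ) < a := by exact_mod_cast ha
  have hL0 : (0 : ℝ) < L := by exact_mod_cast ha.trans haL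
  have h1 : (m.choose a : ℝ) ≤ (m : ℝ) ^ a / a.factorial := Nat.choose_le_pow_div a m
  have h2 : (a : ℝ) ^ a / a.factorial ≤ Real.exp a := Real.pow_div_factorial_le_exp _ ha0.le a
  have h3 : Real.exp (subsetEntropy L a) = Real.exp a * ((L : ℝ) / a) ^ a := by
    rw [subsetEntropy, mul_add, mul_one, Real.exp_add, Real.exp_nat_mul,
      Real.exp_log (by positivity)]
  rw [h3]
  calc (m.choose a : ℝ) ≤ (L : ℝ) ^ a / a.factorial := by
        refine h1.trans ?_
        gcongr
    _ = (a : ℝ) ^ a / a.factorial * ((L : ℝ) / a) ^ a := by rw [div_pow]; field_simp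
    _ ≤ _ := by gcongr

/-- The entropy is smallest for singletons, by `log a ≤ a - 1`. This makes any spare multiple of the
entropy worth a power of `L`. -/
theorem le_subsetEntropy {L a : ℕ} (ha : 1 ≤ a) (haL : a ≤ L) :
    1 + Real.log L ≤ subsetEntropy L a := by
  have ha0 : (1 : ℝ) ≤ a := by exact_mod_cast ha
  have haL' : (a : ℝ) ≤ L := by exact_mod_cast haL
  have hL0 : (0 : ℝ) < L := by linarith
  have h1 : Real.log L = Real.log a + Real.log ((L : ℝ) / a) := by
    rw [← Real.log_mul (by positivity) (by positivity)]
    congr 1; field_simp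
  have h2 : 0 ≤ Real.log ((L : ℝ) / a) :=
    Real.log_nonneg ((one_le_div (by positivity)).mpr haL')
  have h3 := Real.log_le_sub_one_of_pos (show (0 : ℝ) < a by positivity)
  rw [subsetEntropy, h1]
  nlinarith

theorem subsetEntropy_nonneg {L a : ℕ} (haL : a ≤ L) : 0 ≤ subsetEntropy L a := by
  rcases Nat.eq_zero_or_pos a with rfl | ha
  · simp [subsetEntropy]
  · have : (1 : ℝ) ≤ L := by exact_mod_cast ha.trans_le haL
    linarith [le_subsetEntropy ha haL, Real.log_nonneg this]

theorem subsetEntropy_le_size {L : ℕ} (hL : 0 < L) (a : ℕ) : subsetEntropy L a ≤ L := by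
  rcases Nat.eq_zero_or_pos a with rfl | ha
  · simp [subsetEntropy]
  have ha0 : (0 : ℝ) < a := by exact_mod_cast ha
  have hL0 : (0 : ℝ) < L := by exact_mod_cast hL
  have h := Real.log_le_sub_one_of_pos (show 0 < (L : ℝ) / a by positivity)
  calc subsetEntropy L a ≤ a * ((L : ℝ) / a) := by rw [subsetEntropy]; gcongr; linarith
    _ = L := by field_simp

/-- One of the five units of entropy pays for the number of sets of a given size; the other four
leave at most `L⁻⁴` per size, and there are at most `L` sizes. -/
theorem sum_exp_neg_subsetEntropy_le {m L : ℕ} (hm : m ≤ L) (hL : 0 < L) :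
    ∑ A : Finset (Fin m) with A.Nonempty, Real.exp (-(5 * subsetEntropy L #A)) ≤
      1 / (L : ℝ) ^ 3 := by
  have hL0 : (0 : ℝ) < L := by exact_mod_cast hL
  have h1 : ∑ A : Finset (Fin m) with A.Nonempty, Real.exp (-(5 * subsetEntropy L #A)) =
      ∑ A ∈ (univ : Finset (Fin m)).powerset,
        (fun k => if k = 0 then 0 else Real.exp (-(5 * subsetEntropy L k))) #A := by
    rw [Finset.powerset_univ, Finset.sum_filter]
    refine Finset.sum_congr rfl fun A _ => ?_
    simp only [card_eq_zero, nonempty_iff_ne_empty]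
    split_ifs <;> simp_all
  rw [h1, Finset.sum_powerset_apply_card
    (fun k => if k = 0 then 0 else Real.exp (-(5 * subsetEntropy L k))), card_univ,
    Fintype.card_fin, Finset.sum_range_succ']
  simp only [Nat.add_eq_zero_iff, one_ne_zero, and_false, if_false, if_true, smul_zero, add_zero]
  calc ∑ k ∈ range m, m.choose (k + 1) • Real.exp (-(5 * subsetEntropy L (k + 1)))
      ≤ ∑ k ∈ range m, 1 / (L : ℝ) ^ 4 := by
        refine Finset.sum_le_sum fun k hk => ?_
        have hk' : k + 1 ≤ L := by have := mem_range.mp hk; lia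
        rw [nsmul_eq_mul]
        have h2 := choose_le_exp_subsetEntropy hm (show 1 ≤ k + 1 by lia) hk'
        have h3 := le_subsetEntropy (show 1 ≤ k + 1 by lia) hk'
        calc _ ≤ Real.exp (subsetEntropy L (k + 1)) * Real.exp (-(5 * subsetEntropy L (k + 1))) :=
              mul_le_mul_of_nonneg_right h2 (Real.exp_pos _).le
          _ = Real.exp (-(4 * subsetEntropy L (k + 1))) := by rw [← Real.exp_add]; congr 1; ring
          _ ≤ Real.exp (-(4 * Real.log L)) := Real.exp_le_exp.mpr (by linarith)
          _ = 1 / (L : ℝ) ^ 4 := by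
              rw [Real.exp_neg, one_div, ← Real.exp_log (pow_pos hL0 4), Real.log_pow]
              norm_num
    _ = m * (1 / (L : ℝ) ^ 4) := by simp
    _ ≤ L * (1 / (L : ℝ) ^ 4) := by gcongr
    _ = _ := by field_simp

variable {m n : ℕ}

/-- With high probability no pair of sets of rows and columns spans many more observed entries than
expected, up to an entropy term. -/
theorem card_discrepancy_le {s L : ℕ} (hs : s ≤ m * n) (hmL : m ≤ L) (hnL : n ≤ L)
    (hL : 0 < L) {p : ℝ} (hp : p = (s : ℝ) / (m * n)) (Φ : Finset ℝ) (hΦ : ∀ φ ∈ Φ, 0 ≤ φ)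
    [DecidablePred fun E : Finset (Fin m × Fin n) =>
      ∃ w ∈ Φ ×ˢ (univ : Finset (Finset (Fin m) × Finset (Fin n))),
      p * #w.2.1 * #w.2.2 * (Real.exp w.1 - 1) +
        5 * (subsetEntropy L #w.2.1 + subsetEntropy L #w.2.2) <
        w.1 * #{e ∈ E | e.1 ∈ w.2.1 ∧ e.2 ∈ w.2.2}] :
    (#{E ∈ powersetCard s (univ : Finset (Fin m × Fin n)) |
      ∃ w ∈ Φ ×ˢ (univ : Finset (Finset (Fin m) × Finset (Fin n))),
      p * #w.2.1 * #w.2.2 * (Real.exp w.1 - 1) +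
        5 * (subsetEntropy L #w.2.1 + subsetEntropy L #w.2.2) <
        w.1 * #{e ∈ E | e.1 ∈ w.2.1 ∧ e.2 ∈ w.2.2}} : ℝ) ≤
      #Φ * ((L ^ 2 + 1) / (L : ℝ) ^ 6) *
        #(powersetCard s (univ : Finset (Fin m × Fin n))) := by
  classical
  have hcard : Fintype.card (Fin m × Fin n) = m * n := by simp
  have hp' : (s : ℝ) / Fintype.card (Fin m × Fin n) = p := by rw [hp, hcard]; push_cast; rfl
  have hp0 : 0 ≤ p := by rw [hp]; positivity
  set Ω := powersetCard s (univ : Finset (Fin m × Fin n)) with hΩ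
  have hmn : ((Fintype.card (Fin m × Fin n) : ℕ) : ℝ) ≤ (L : ℝ) ^ 2 := by
    rw [hcard, sq]; exact_mod_cast Nat.mul_le_mul hmL hnL
  have hA : ∀ A : Finset (Fin m), #A ≤ L := fun A => (card_finset_fin_le A).trans hmL
  have hB : ∀ B : Finset (Fin n), #B ≤ L := fun B => (card_finset_fin_le B).trans hnL
  -- The empty set has entropy `0`, so the exponential would not be small there. It may be given
  -- weight `0`, because an empty rectangle contains no positions and cannot violate the bound.
  let c : Finset (Fin m) → ℝ := fun A =>
    if A.Nonempty then Real.exp (-(5 * subsetEntropy L #A)) else 0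
  let c' : Finset (Fin n) → ℝ := fun B =>
    if B.Nonempty then Real.exp (-(5 * subsetEntropy L #B)) else 0
  refine (card_filter_exists_le Ω _ _
    (c := fun w => (L ^ 2 + 1) * #Ω * (c w.2.1 * c' w.2.2)) fun w hw => ?_).trans ?_
  · obtain ⟨φ, A, B⟩ := w
    have hφ := hΦ φ (mem_product.mp hw).1
    have he : 0 ≤ Real.exp φ - 1 := by linarith [Real.one_le_exp hφ]
    by_cases hne : A.Nonempty ∧ B.Nonempty
    · simp only [c, c', if_pos hne.1, if_pos hne.2]
      have h := card_le_sum_le_exp (hs.trans_eq hcard.symm)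
        (fun e : Fin m × Fin n => if e.1 ∈ A ∧ e.2 ∈ B then φ else 0)
        (p * #A * #B * (Real.exp φ - 1) + 5 * (subsetEntropy L #A + subsetEntropy L #B))
      have h1 : ∑ e : Fin m × Fin n, (Real.exp (if e.1 ∈ A ∧ e.2 ∈ B then φ else 0) - 1) =
          #A * #B * (Real.exp φ - 1) := by
        have : ∀ e : Fin m × Fin n, Real.exp (if e.1 ∈ A ∧ e.2 ∈ B then φ else 0) - 1 =
            if e ∈ A ×ˢ B then Real.exp φ - 1 else 0 := fun e => by
          simp only [mem_product]; split_ifs <;> simp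
        rw [Finset.sum_congr rfl fun e _ => this e, Finset.sum_ite_mem, univ_inter,
          Finset.sum_const, card_product, nsmul_eq_mul]
        push_cast; ring
      have h2 : ∀ E : Finset (Fin m × Fin n), ∑ e ∈ E, (if e.1 ∈ A ∧ e.2 ∈ B then φ else 0) =
          φ * #{e ∈ E | e.1 ∈ A ∧ e.2 ∈ B} := fun E => by
        rw [← Finset.sum_filter, Finset.sum_const, nsmul_eq_mul, mul_comm]
      simp only [hp', h1, h2] at h
      refine le_trans ?_ (h.trans ?_)
      · rw [Nat.cast_le]
        refine card_le_card fun E hE => ?_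
        rw [mem_filter] at hE ⊢
        exact ⟨hE.1, hE.2.le⟩
      · rw [← Real.exp_add]
        gcongr
        linarith
    · have : #{E ∈ Ω | p * #A * #B * (Real.exp φ - 1) +
          5 * (subsetEntropy L #A + subsetEntropy L #B) <
          φ * #{e ∈ E | e.1 ∈ A ∧ e.2 ∈ B}} = 0 := by
        rw [card_eq_zero, filter_eq_empty_iff]
        intro E _
        have h0 : #{e ∈ E | e.1 ∈ A ∧ e.2 ∈ B} = 0 := by
          rw [card_eq_zero, filter_eq_empty_iff]
          rintro e _ ⟨h1, h2⟩
          exact hne ⟨⟨_, h1⟩, ⟨_, h2⟩⟩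
        rw [h0, Nat.cast_zero, mul_zero, not_lt]
        have h1 := subsetEntropy_nonneg (hA A)
        have h2 := subsetEntropy_nonneg (hB B)
        positivity
      rw [this]
      simp only [c, c']
      push_cast
      positivity
  · have h0 : ∑ y : Finset (Fin m) × Finset (Fin n), c y.1 * c' y.2 =
        (∑ A, c A) * ∑ B, c' B := by
      rw [Fintype.sum_prod_type, Finset.sum_mul_sum]
    have h1 : ∑ A, c A ≤ 1 / (L : ℝ) ^ 3 := by
      simp only [c]; rw [← Finset.sum_filter]; exact sum_exp_neg_subsetEntropy_le hmL hL
    have h2 : ∑ B, c' B ≤ 1 / (L : ℝ) ^ 3 := by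
      simp only [c']; rw [← Finset.sum_filter]; exact sum_exp_neg_subsetEntropy_le hnL hL
    have h3 : 0 ≤ ∑ B, c' B := Finset.sum_nonneg fun B _ => by simp only [c']; positivity
    rw [Finset.sum_product]
    dsimp only
    rw [Finset.sum_const, nsmul_eq_mul, ← Finset.mul_sum, h0]
    calc _ ≤ #Φ * (((L : ℝ) ^ 2 + 1) * #Ω * (1 / (L : ℝ) ^ 3 * (1 / (L : ℝ) ^ 3))) := by
          gcongr
      _ = _ := by field_simp

end RankEstimation

/-! ### Summing the entropy terms over dyadic scales -/

namespace RankEstimation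

/-- A geometric sum is dominated by its largest term, up to `r/(r - 1) ≤ 4`. The application has
ratio `√2 ≥ 4/3`. -/
theorem sum_geometric_le_of_le {S : Finset ℕ} {r c X : ℝ} (hr : 4 / 3 ≤ r) (hc : 0 ≤ c)
    (hX : 0 ≤ X) (h : ∀ k ∈ S, c * r ^ k ≤ X) : ∑ k ∈ S, c * r ^ k ≤ 4 * X := by
  rcases S.eq_empty_or_nonempty with rfl | hS
  · simpa using hX
  have hK := h _ (S.max'_mem hS)
  set K := S.max' hS
  have hr0 : 0 < r := by linarith
  have h1 : ∑ k ∈ S, c * r ^ k ≤ ∑ k ∈ range (K + 1), c * r ^ k :=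
    Finset.sum_le_sum_of_subset_of_nonneg
      (fun k hk => mem_range.mpr (Nat.lt_succ_of_le (S.le_max' k hk))) fun _ _ _ => by positivity
  refine h1.trans ?_
  rw [← Finset.mul_sum, geom_sum_eq (by linarith), mul_div_assoc', div_le_iff₀ (by linarith),
    pow_succ]
  nlinarith

/-- Replacing `log q` by `log Q` in the denominator costs at most `1 + log(Q/q) ≤ 2√(Q/q)`. What
remains grows like `√q`, so it can be summed geometrically over dyadic `q` up to `Q`. -/
theorem div_one_add_log_le {q Q : ℝ} (hq : 1 ≤ q) (hQ : q ≤ Q) :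
    q / (1 + Real.log q) ≤ 2 * (√q * √Q) / (1 + Real.log Q) := by
  have hq0 : 0 < q := by linarith
  have hQ0 : 0 < Q := by linarith
  have h1 : 0 ≤ Real.log q := Real.log_nonneg hq
  have h2 : 0 ≤ Real.log (Q / q) := Real.log_nonneg ((one_le_div hq0).mpr hQ)
  have h3 : Real.log Q = Real.log q + Real.log (Q / q) := by
    rw [← Real.log_mul hq0.ne' (by positivity)]; congr 1; field_simp
  have h4 : 1 + Real.log (Q / q) ≤ 2 * √(Q / q) := by
    have h5 := Real.log_le_sub_one_of_pos (show 0 < √(Q / q) by positivity)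
    rw [Real.log_sqrt (by positivity)] at h5
    linarith
  have h6 : q * √(Q / q) = √q * √Q := by
    rw [Real.sqrt_div hQ0.le]
    have := Real.mul_self_sqrt hq0.le
    field_simp
    nlinarith
  rw [div_le_div_iff₀ (by linarith) (by linarith), ← h6]
  have h7 : 1 + Real.log Q ≤ 2 * √(Q / q) * (1 + Real.log q) := by
    rw [h3]; nlinarith
  nlinarith

/-- Apply `log x ≤ x - 1` to `x = 2⁻ˡ/β`. The term `β l` will be absorbed by a logarithm of size
`l`, and `2⁻ˡ` is summable in `l`. -/
theorem mul_log_inv_le {β : ℝ} (hβ : 0 < β) (l : ℕ) :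
    β * Real.log (1 / β) ≤ β * l + (1 / 2) ^ l := by
  have h := Real.log_le_sub_one_of_pos (show 0 < (1 / 2) ^ l / β by positivity)
  rw [Real.log_div (by positivity) hβ.ne', Real.log_pow] at h
  have h2 : Real.log (1 / 2) = -Real.log 2 := by simp
  have h3 : Real.log 2 ≤ 1 := by linarith [Real.log_two_lt_d9]
  have h4 : β * ((1 / 2) ^ l / β) = (1 / 2) ^ l := by field_simp
  have h5 : β * (-Real.log β) ≤ β * (l + ((1 / 2) ^ l / β)) := by
    refine mul_le_mul_of_nonneg_left ?_ hβ.le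
    rw [h2] at h
    have : (l : ℝ) * Real.log 2 ≤ l * 1 := by gcongr
    linarith
  rw [one_div, Real.log_inv]
  linarith

/-- The entropy terms of the discrepancy bound, summed over one dyadic scale. -/
theorem sum_level_entropy_le {L b l : ℕ} (hL : 0 < L) (hb : 4 ^ l * b ≤ L) {D : ℝ} (hD : 0 < D)
    {S : Finset ℕ} (hS : ∀ k ∈ S, D ≤ 2 ^ (k + l + 2) ∧ (2 : ℝ) ^ k ≤ D * 2 ^ (l + 1)) :
    ∑ k ∈ S, 2 ^ (k + l) * subsetEntropy L b / (1 + Real.log (2 ^ (k + l + 2) / D)) ≤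
      16 * D * (2 * (4 ^ l * b) + L * (1 / 2) ^ l) := by
  have hL0 : (0 : ℝ) < L := by exact_mod_cast hL
  rcases Nat.eq_zero_or_pos b with rfl | hb0
  · simp [subsetEntropy]; positivity
  have hb1 : (0 : ℝ) < b := by exact_mod_cast hb0
  -- The balance condition `2^k ≤ D 2^(l+1)` bounds every ratio `2^(k+l+2)/D` by this `Q`, and `log
  -- Q ≥ l`.
  set Q : ℝ := 8 * 4 ^ l with hQ
  have hQ1 : 1 ≤ Q := by
    have : (1 : ℝ) ≤ 4 ^ l := one_le_pow₀ (by norm_num)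
    linarith
  have hlogQ : Real.log Q = Real.log 8 + l * Real.log 4 := by
    rw [hQ, Real.log_mul (by norm_num) (by positivity), Real.log_pow]
  have hlog4 : 1 ≤ Real.log 4 := by
    rw [show (4 : ℝ) = 2 ^ 2 by norm_num, Real.log_pow]
    push_cast; linarith [Real.log_two_gt_d9]
  have hlog8 : 0 ≤ Real.log 8 := Real.log_nonneg (by norm_num)
  have hlogQl : (l : ℝ) ≤ Real.log Q := by
    have : (l : ℝ) * 1 ≤ l * Real.log 4 := by gcongr
    linarith
  have hbL : b ≤ L := le_trans (Nat.le_mul_of_pos_left b (by positivity)) hb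
  have hent : 0 ≤ subsetEntropy L b := subsetEntropy_nonneg hbL
  have hqQ : ∀ k ∈ S, (2 : ℝ) ^ (k + l + 2) / D ≤ Q := by
    intro k hk
    rw [div_le_iff₀ hD]
    have h := (hS k hk).2
    calc (2 : ℝ) ^ (k + l + 2) = 2 ^ k * 2 ^ (l + 2) := by ring
      _ ≤ D * 2 ^ (l + 1) * 2 ^ (l + 2) := by gcongr
      _ = Q * D := by
        rw [hQ, show (4 : ℝ) = 2 * 2 by norm_num, mul_pow]; ring
  have hsum : ∑ k ∈ S, √((2 : ℝ) ^ (k + l + 2) / D) ≤ 4 * √Q := by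
    have h1 : ∀ k : ℕ, √((2 : ℝ) ^ (k + l + 2) / D) = √((2 : ℝ) ^ (l + 2) / D) * √2 ^ k := by
      intro k
      have h2 : √2 ^ k = √((2 : ℝ) ^ k) := by
        induction k with
        | zero => simp
        | succ k ih => rw [pow_succ, pow_succ, ih, Real.sqrt_mul (by positivity)]
      rw [h2, ← Real.sqrt_mul (by positivity)]
      congr 1; ring
    simp only [h1]
    refine sum_geometric_le_of_le ?_ (Real.sqrt_nonneg _) (Real.sqrt_nonneg _) fun k hk => ?_
    · exact Real.le_sqrt_of_sq_le (by norm_num)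
    · rw [← h1]; exact Real.sqrt_le_sqrt (hqQ k hk)
  have hmain : ∑ k ∈ S, 2 ^ (k + l) * subsetEntropy L b / (1 + Real.log (2 ^ (k + l + 2) / D)) ≤
      16 * D * 4 ^ l * subsetEntropy L b / (1 + Real.log Q) := by
    calc _ ≤ ∑ k ∈ S, D / 4 * subsetEntropy L b * (2 * √Q / (1 + Real.log Q)) *
          √((2 : ℝ) ^ (k + l + 2) / D) := by
          refine Finset.sum_le_sum fun k hk => ?_
          have h1 := div_one_add_log_le ((one_le_div hD).mpr (hS k hk).1) (hqQ k hk)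
          have h2 : (2 : ℝ) ^ (k + l) = D / 4 * (2 ^ (k + l + 2) / D) := by
            rw [pow_add _ (k + l) 2]; field_simp; norm_num
          calc _ = D / 4 * subsetEntropy L b *
                (2 ^ (k + l + 2) / D / (1 + Real.log (2 ^ (k + l + 2) / D))) := by
                rw [h2]; ring
            _ ≤ D / 4 * subsetEntropy L b *
                (2 * (√((2 : ℝ) ^ (k + l + 2) / D) * √Q) / (1 + Real.log Q)) := by gcongr
            _ = _ := by ring
      _ ≤ D / 4 * subsetEntropy L b * (2 * √Q / (1 + Real.log Q)) * (4 * √Q) := by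
          rw [← Finset.mul_sum]
          have : 0 ≤ 1 + Real.log Q := by linarith [Real.log_nonneg hQ1]
          gcongr
      _ = 2 * D * subsetEntropy L b * (√Q * √Q) / (1 + Real.log Q) := by ring
      _ = _ := by rw [Real.mul_self_sqrt (by linarith), hQ]; ring
  refine hmain.trans ?_
  -- In this variable `log(L/b) = l log 4 + log(1/β)`. The first summand cancels against `1 + log
  -- Q`; the second is the subject of `mul_log_inv_le`.
  set β : ℝ := 4 ^ l * b / L with hβ
  have hβ0 : 0 < β := by positivity
  have hlogb : Real.log ((L : ℝ) / b) = l * Real.log 4 + Real.log (1 / β) := by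
    rw [← Real.log_pow, ← Real.log_mul (by positivity) (by positivity)]
    congr 1; rw [hβ]; field_simp
  have hβl := mul_log_inv_le hβ0 l
  have h1 : (4 : ℝ) ^ l * subsetEntropy L b = L * (β * (1 + l * Real.log 4) +
      β * Real.log (1 / β)) := by
    rw [subsetEntropy, hlogb, hβ]; field_simp; ring
  have hden : 0 < 1 + Real.log Q := by linarith [Real.log_nonneg hQ1]
  rw [div_le_iff₀ hden]
  calc 16 * D * 4 ^ l * subsetEntropy L b = 16 * D * (L * (β * (1 + l * Real.log 4) +
        β * Real.log (1 / β))) := by rw [mul_assoc _ ((4 : ℝ) ^ l), h1]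
    _ ≤ 16 * D * (L * ((2 * β + (1 / 2) ^ l) * (1 + Real.log Q))) := by
        gcongr
        have h2 : β * (1 + l * Real.log 4) ≤ β * (1 + Real.log Q) := by gcongr; linarith
        have h3 : β * l ≤ β * (1 + Real.log Q) := by gcongr; linarith
        have h4 : (1 / 2 : ℝ) ^ l * 1 ≤ (1 / 2) ^ l * (1 + Real.log Q) := by
          gcongr; linarith [Real.log_nonneg hQ1]
        linarith
    _ = _ := by
        have : L * β = 4 ^ l * b := by rw [hβ]; field_simp
        rw [← this]; ring

/-- The two terms of the bound for one scale are summable for different reasons: `4^l b l` by the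
constraint on the vector, `2⁻ˡ` as a geometric series. -/
theorem sum_entropy_le {L : ℕ} (hL : 0 < L) {K : ℕ} {b : ℕ → ℕ}
    (hb : ∑ l ∈ range K, 4 ^ l * b l ≤ L) {D : ℝ} (hD : 0 < D) {S : ℕ → Finset ℕ}
    (hS : ∀ l ∈ range K, ∀ k ∈ S l, D ≤ 2 ^ (k + l + 2) ∧ (2 : ℝ) ^ k ≤ D * 2 ^ (l + 1)) :
    ∑ l ∈ range K, ∑ k ∈ S l,
      2 ^ (k + l) * subsetEntropy L (b l) / (1 + Real.log (2 ^ (k + l + 2) / D)) ≤ 64 * D * L := by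
  have hb' : ∑ l ∈ range K, (4 : ℝ) ^ l * b l ≤ L := by exact_mod_cast hb
  calc _ ≤ ∑ l ∈ range K, 16 * D * (2 * (4 ^ l * b l) + L * (1 / 2) ^ l) :=
        Finset.sum_le_sum fun l hl => sum_level_entropy_le hL
          ((Finset.single_le_sum (f := fun l => 4 ^ l * b l) (fun _ _ => Nat.zero_le _) hl).trans
            hb) hD (hS l hl)
    _ = 16 * D * (2 * ∑ l ∈ range K, (4 : ℝ) ^ l * b l + L * ∑ l ∈ range K, (1 / 2) ^ l) := by
        rw [← Finset.mul_sum, Finset.sum_add_distrib, ← Finset.mul_sum, ← Finset.mul_sum]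
    _ ≤ 16 * D * (2 * L + L * 2) := by
        gcongr
        exact sum_geometric_two_le K
    _ = _ := by ring

end RankEstimation

/-! ### Heavy pairs -/

namespace RankEstimation

/-- The dyadic scale of a real number `x ≥ 1`. -/
noncomputable def level (x : ℝ) : ℕ := Nat.log 2 ⌊x⌋₊

theorem two_pow_level_le {x : ℝ} (hx : 1 ≤ x) : (2 : ℝ) ^ level x ≤ x := by
  have h1 : ⌊x⌋₊ ≠ 0 := (Nat.floor_pos.mpr hx).ne'
  have h2 : 2 ^ level x ≤ ⌊x⌋₊ := Nat.pow_log_le_self 2 h1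
  calc (2 : ℝ) ^ level x = ((2 ^ level x : ℕ) : ℝ) := by push_cast; rfl
    _ ≤ ⌊x⌋₊ := by exact_mod_cast h2
    _ ≤ x := Nat.floor_le (by linarith)

theorem lt_two_pow_level (x : ℝ) : x < 2 ^ (level x + 1) := by
  have h2 : ⌊x⌋₊ < 2 ^ (level x + 1) := Nat.lt_pow_succ_log_self (by norm_num) _
  have := (Nat.floor_lt' (by positivity)).mp h2
  exact_mod_cast this

/-- An entry of level `k` has square at least `4^k`, so the level sets of a vector cannot weigh more
than its squared length. -/
theorem sum_four_pow_level_le {m L : ℕ} {u : Fin m → ℝ} (hu : ∑ i, u i ^ 2 ≤ (L : ℝ)) (K : ℕ) :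
    ∑ k ∈ range K, 4 ^ k * #{i | 1 ≤ u i ∧ level (u i) = k} ≤ L := by
  have h : ((∑ k ∈ range K, 4 ^ k * #{i | 1 ≤ u i ∧ level (u i) = k} : ℕ) : ℝ) ≤ L := by
    refine le_trans ?_ hu
    push_cast
    calc _ = ∑ k ∈ range K, ∑ i with 1 ≤ u i ∧ level (u i) = k, (4 : ℝ) ^ level (u i) := by
          refine Finset.sum_congr rfl fun k _ => ?_
          rw [Finset.sum_congr rfl fun i hi => by rw [(mem_filter.mp hi).2.2], Finset.sum_const,
            nsmul_eq_mul, mul_comm]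
      _ = ∑ k ∈ range K, ∑ i ∈ ({i | 1 ≤ u i} : Finset (Fin m)) with level (u i) = k,
            (4 : ℝ) ^ level (u i) := by
          simp only [Finset.filter_filter]
      _ ≤ ∑ i with 1 ≤ u i, (4 : ℝ) ^ level (u i) :=
          Finset.sum_fiberwise_le_sum_of_sum_fiber_nonneg fun k _ =>
            Finset.sum_nonneg fun _ _ => by positivity
      _ ≤ ∑ i with 1 ≤ u i, u i ^ 2 := by
          refine Finset.sum_le_sum fun i hi => ?_
          have h1 := two_pow_level_le (mem_filter.mp hi).2
          rw [show (4 : ℝ) = 2 ^ 2 by norm_num, ← pow_mul, mul_comm, pow_mul]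
          exact pow_le_pow_left₀ (by positivity) h1 2
      _ ≤ ∑ i, u i ^ 2 :=
          Finset.sum_le_sum_of_subset_of_nonneg (filter_subset _ _) fun _ _ _ => sq_nonneg _
  exact_mod_cast h

variable {m n : ℕ}

/-- The exponents used in the discrepancy bound for heavy pairs. -/
noncomputable def scaleExponent (D : ℝ) (t : ℕ) : ℝ := 1 + Real.log (max 1 (2 ^ (t + 2) / D))

theorem one_le_scaleExponent (D : ℝ) (t : ℕ) : 1 ≤ scaleExponent D t := by
  have := Real.log_nonneg (le_max_left 1 ((2 : ℝ) ^ (t + 2) / D))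
  rw [scaleExponent]; linarith

/-- The contribution of the pairs that are heavy and balanced, under the discrepancy bound. -/
theorem sum_balanced_le {L : ℕ} (hL : 0 < L) {p D : ℝ} (hD : 0 < D)
    (hpD : p * L = D ^ 2) {E F : Finset (Fin m × Fin n)} (hFE : F ⊆ E)
    {u : Fin m → ℝ} {v : Fin n → ℝ} (hu : ∑ i, u i ^ 2 ≤ (L : ℝ)) (hv : ∑ j, v j ^ 2 ≤ (L : ℝ))
    (hF : ∀ e ∈ F, 0 < u e.1 ∧ 0 < v e.2 ∧ D < u e.1 * v e.2 ∧ u e.1 < D * v e.2 ∧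
      v e.2 < D * u e.1)
    (hE : ∀ t < 2 * L, ∀ (A : Finset (Fin m)) (B : Finset (Fin n)),
      scaleExponent D t * #{e ∈ E | e.1 ∈ A ∧ e.2 ∈ B} ≤
        p * #A * #B * (Real.exp (scaleExponent D t) - 1) +
          5 * (subsetEntropy L #A + subsetEntropy L #B)) :
    ∑ e ∈ F, u e.1 * v e.2 ≤ 2608 * D * L := by
  have hL0 : (0 : ℝ) < L := by exact_mod_cast hL
  have hp0 : 0 ≤ p := by
    by_contra h
    push Not at h
    nlinarith [sq_nonneg D]
  -- If `u < 1`, then `v < D u` would give `u v < D u² < D`, against heaviness; likewise for `v`. So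
  -- all entries in play have a dyadic level.
  have hone : ∀ e ∈ F, 1 ≤ u e.1 ∧ 1 ≤ v e.2 := by
    intro e he
    obtain ⟨h1, h2, h3, h4, h5⟩ := hF e he
    constructor
    · by_contra h
      push Not at h
      nlinarith [mul_lt_mul_of_pos_left h5 h1, mul_lt_mul_of_pos_left h h1]
    · by_contra h
      push Not at h
      nlinarith [mul_lt_mul_of_pos_right h4 h2, mul_lt_mul_of_pos_left h h2]
  have hlev : ∀ {N : ℕ} (w : Fin N → ℝ), ∑ i, w i ^ 2 ≤ (L : ℝ) → ∀ i, 1 ≤ w i →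
      level (w i) < L := by
    intro N w hw i hi
    have h1 : w i ^ 2 ≤ L := (Finset.single_le_sum (f := fun i => w i ^ 2)
      (fun _ _ => sq_nonneg _) (mem_univ i)).trans hw
    have h2 := two_pow_level_le hi
    have h3 : (2 : ℝ) ^ level (w i) ≤ L := by nlinarith
    have h4 : 2 ^ level (w i) ≤ L := by exact_mod_cast h3
    exact (Nat.lt_two_pow_self).trans_le h4
  let A : ℕ → Finset (Fin m) := fun k => {i | 1 ≤ u i ∧ level (u i) = k}
  let B : ℕ → Finset (Fin n) := fun l => {j | 1 ≤ v j ∧ level (v j) = l}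
  have hA : ∑ k ∈ range L, 4 ^ k * #(A k) ≤ L := sum_four_pow_level_le hu L
  have hB : ∑ l ∈ range L, 4 ^ l * #(B l) ≤ L := sum_four_pow_level_le hv L
  let R : ℕ → ℕ → Prop := fun k l => D ≤ 2 ^ (k + l + 2) ∧ (2 : ℝ) ^ k ≤ D * 2 ^ (l + 1) ∧
    (2 : ℝ) ^ l ≤ D * 2 ^ (k + 1)
  classical
  let P : Finset (ℕ × ℕ) := {q ∈ range L ×ˢ range L | R q.1 q.2}
  have hmaps : ∀ e ∈ F, (level (u e.1), level (v e.2)) ∈ P := by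
    intro e he
    obtain ⟨h1, h2⟩ := hone e he
    obtain ⟨-, -, h3, h4, h5⟩ := hF e he
    have a1 := two_pow_level_le h1
    have a2 := two_pow_level_le h2
    have b1 := lt_two_pow_level (u e.1)
    have b2 := lt_two_pow_level (v e.2)
    refine mem_filter.mpr ⟨mem_product.mpr ⟨mem_range.mpr (hlev u hu _ h1),
      mem_range.mpr (hlev v hv _ h2)⟩, ?_, ?_, ?_⟩
    · calc D ≤ u e.1 * v e.2 := h3.le
        _ ≤ 2 ^ (level (u e.1) + 1) * 2 ^ (level (v e.2) + 1) := by gcongr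
        _ = _ := by ring
    · exact a1.trans (h4.le.trans (by gcongr))
    · exact a2.trans (h5.le.trans (by gcongr))
  have hfib : ∀ q ∈ P, ∑ e ∈ F with (level (u e.1), level (v e.2)) = q, u e.1 * v e.2 ≤
      4 * (12 * (p / D) * ((4 ^ q.1 * #(A q.1)) * (4 ^ q.2 * #(B q.2))) +
        5 * (2 ^ (q.1 + q.2) * subsetEntropy L #(A q.1) /
            (1 + Real.log (2 ^ (q.1 + q.2 + 2) / D))) +
        5 * (2 ^ (q.1 + q.2) * subsetEntropy L #(B q.2) /
            (1 + Real.log (2 ^ (q.1 + q.2 + 2) / D)))) := by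
    rintro ⟨k, l⟩ hq
    obtain ⟨hq1, hR, -, -⟩ := mem_filter.mp hq
    obtain ⟨hk, hl⟩ := mem_product.mp hq1
    rw [mem_range] at hk hl
    dsimp only at *
    set x : ℝ := 2 ^ (k + l + 2) / D with hx
    have hx1 : 1 ≤ x := (one_le_div hD).mpr hR
    have hφ : scaleExponent D (k + l) = 1 + Real.log x := by
      rw [scaleExponent, max_eq_right hx1]
    have hlogx := Real.log_nonneg hx1
    clear_value x
    -- The exponent `φ` is chosen with `exp φ = e x`: the excess factor `x` keeps the main term
    -- summable, and division by `φ = 1 + log x` gains the logarithm in the entropy terms.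
    have hdisc := hE (k + l) (by lia) (A k) (B l)
    rw [hφ, Real.exp_add, Real.exp_log (by linarith)] at hdisc
    have hexp : Real.exp 1 < 3 := Real.exp_one_lt_three
    have hcount : (#{e ∈ E | e.1 ∈ A k ∧ e.2 ∈ B l} : ℝ) ≤ 3 * (p * #(A k) * #(B l) * x) +
        5 * (subsetEntropy L #(A k) / (1 + Real.log x)) +
        5 * (subsetEntropy L #(B l) / (1 + Real.log x)) := by
      have h1 : 0 < 1 + Real.log x := by linarith
      have h2 : 0 ≤ p * #(A k) * #(B l) := by positivity
      have h3 : p * #(A k) * #(B l) * (Real.exp 1 * x - 1) ≤ 3 * (p * #(A k) * #(B l) * x) := by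
        calc _ ≤ p * #(A k) * #(B l) * (3 * x) := by gcongr; nlinarith
          _ = _ := by ring
      have h4 : 3 * (p * #(A k) * #(B l) * x) ≤
          3 * (p * #(A k) * #(B l) * x) * (1 + Real.log x) :=
        le_mul_of_one_le_right (by positivity) (by linarith)
      rw [mul_comm] at hdisc
      rw [← mul_div_assoc, ← mul_div_assoc, add_assoc, ← add_div, ← sub_le_iff_le_add',
        le_div_iff₀ h1]
      linarith
    have hsum : ∑ e ∈ F with (level (u e.1), level (v e.2)) = (k, l), u e.1 * v e.2 ≤
        4 * 2 ^ (k + l) * #{e ∈ E | e.1 ∈ A k ∧ e.2 ∈ B l} := by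
      calc _ ≤ ∑ e ∈ F with (level (u e.1), level (v e.2)) = (k, l), 4 * (2 : ℝ) ^ (k + l) := by
            refine Finset.sum_le_sum fun e he => ?_
            obtain ⟨he, hkl⟩ := mem_filter.mp he
            obtain ⟨h1, h2⟩ := Prod.mk.inj hkl
            have b1 := lt_two_pow_level (u e.1)
            have b2 := lt_two_pow_level (v e.2)
            rw [h1] at b1
            rw [h2] at b2
            calc u e.1 * v e.2 ≤ 2 ^ (k + 1) * 2 ^ (l + 1) := by
                  have := (hF e he).2.1
                  gcongr
              _ = _ := by ring
        _ = 4 * 2 ^ (k + l) * #{e ∈ F | (level (u e.1), level (v e.2)) = (k, l)} := by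
            rw [Finset.sum_const, nsmul_eq_mul, mul_comm]
        _ ≤ _ := by
            gcongr ?_ * ((?_ : ℕ) : ℝ)
            refine card_le_card fun e he => ?_
            obtain ⟨he, hkl⟩ := mem_filter.mp he
            obtain ⟨h1, h2⟩ := Prod.mk.inj hkl
            obtain ⟨c1, c2⟩ := hone e he
            exact mem_filter.mpr ⟨hFE he, mem_filter.mpr ⟨mem_univ _, c1, h1⟩,
              mem_filter.mpr ⟨mem_univ _, c2, h2⟩⟩
    refine hsum.trans ?_
    calc _ ≤ 4 * 2 ^ (k + l) * (3 * (p * #(A k) * #(B l) * x) +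
        5 * (subsetEntropy L #(A k) / (1 + Real.log x)) +
        5 * (subsetEntropy L #(B l) / (1 + Real.log x))) := by gcongr
      _ = _ := by
        have h1 : (2 : ℝ) ^ (k + l) * x = 4 / D * (4 ^ k * 4 ^ l) := by
          rw [hx, show (4 : ℝ) ^ k * 4 ^ l = 2 ^ (k + l) * 2 ^ (k + l) by
            rw [← pow_add, ← mul_pow]; norm_num]
          rw [pow_add _ (k + l) 2]
          ring
        calc _ = 4 * (3 * p * #(A k) * #(B l) * (2 ^ (k + l) * x) +
              5 * (2 ^ (k + l) * subsetEntropy L #(A k) / (1 + Real.log x)) +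
              5 * (2 ^ (k + l) * subsetEntropy L #(B l) / (1 + Real.log x))) := by ring
          _ = _ := by rw [h1]; ring
  rw [← Finset.sum_fiberwise_of_maps_to hmaps]
  refine (Finset.sum_le_sum hfib).trans ?_
  clear hfib hmaps
  clear_value A B
  rw [← Finset.mul_sum, Finset.sum_add_distrib, Finset.sum_add_distrib, ← Finset.mul_sum,
    ← Finset.mul_sum, ← Finset.mul_sum]
  have hA' : ∑ k ∈ range L, (4 : ℝ) ^ k * #(A k) ≤ L := by
    have := (Nat.cast_le (α := ℝ)).mpr hA
    push_cast at this
    exact this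
  have hB' : ∑ l ∈ range L, (4 : ℝ) ^ l * #(B l) ≤ L := by
    have := (Nat.cast_le (α := ℝ)).mpr hB
    push_cast at this
    exact this
  have s1 : ∑ q ∈ P, ((4 : ℝ) ^ q.1 * #(A q.1)) * (4 ^ q.2 * #(B q.2)) ≤ L * L := by
    calc _ ≤ ∑ q ∈ range L ×ˢ range L, ((4 : ℝ) ^ q.1 * #(A q.1)) * (4 ^ q.2 * #(B q.2)) :=
          Finset.sum_le_sum_of_subset_of_nonneg (filter_subset _ _) fun _ _ _ => by positivity
      _ = (∑ k ∈ range L, (4 : ℝ) ^ k * #(A k)) * ∑ l ∈ range L, (4 : ℝ) ^ l * #(B l) := by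
          rw [Finset.sum_product, Finset.sum_mul_sum]
      _ ≤ _ := mul_le_mul hA' hB' (Finset.sum_nonneg fun _ _ => by positivity) hL0.le
  have hPsum : ∀ f : ℕ → ℕ → ℝ, ∑ q ∈ P, f q.1 q.2 =
      ∑ l ∈ range L, ∑ k ∈ range L with R k l, f k l := by
    intro f
    rw [Finset.sum_filter, Finset.sum_product, Finset.sum_comm]
    refine Finset.sum_congr rfl fun l _ => ?_
    rw [Finset.sum_filter]
  have hPsum' : ∀ f : ℕ → ℕ → ℝ, ∑ q ∈ P, f q.1 q.2 =
      ∑ k ∈ range L, ∑ l ∈ range L with R k l, f k l := by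
    intro f
    rw [hPsum]
    simp only [Finset.sum_filter]
    rw [Finset.sum_comm]
  have s3 : ∑ q ∈ P, 2 ^ (q.1 + q.2) * subsetEntropy L #(B q.2) /
      (1 + Real.log (2 ^ (q.1 + q.2 + 2) / D)) ≤ 64 * D * L := by
    rw [hPsum fun k l => 2 ^ (k + l) * subsetEntropy L #(B l) /
      (1 + Real.log (2 ^ (k + l + 2) / D))]
    exact sum_entropy_le hL hB hD fun l _ k hk =>
      ⟨(mem_filter.mp hk).2.1, (mem_filter.mp hk).2.2.1⟩
  have s2 : ∑ q ∈ P, 2 ^ (q.1 + q.2) * subsetEntropy L #(A q.1) /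
      (1 + Real.log (2 ^ (q.1 + q.2 + 2) / D)) ≤ 64 * D * L := by
    rw [hPsum' fun k l => 2 ^ (k + l) * subsetEntropy L #(A k) /
      (1 + Real.log (2 ^ (k + l + 2) / D))]
    have := sum_entropy_le hL hA hD (S := fun k => {l ∈ range L | R k l}) fun k _ l hl =>
      ⟨by rw [add_comm l k]; exact (mem_filter.mp hl).2.1, (mem_filter.mp hl).2.2.2⟩
    refine le_trans (le_of_eq ?_) this
    refine Finset.sum_congr rfl fun k _ => Finset.sum_congr rfl fun l _ => ?_
    ring_nf
  have hpL : p / D * (L * L) = D * L := by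
    have : p * (L * L) = D ^ 2 * L := by rw [← hpD]; ring
    rw [div_mul_eq_mul_div, this]; field_simp
  have s1' : 12 * (p / D) * ∑ q ∈ P, ((4 : ℝ) ^ q.1 * #(A q.1)) * (4 ^ q.2 * #(B q.2)) ≤
      12 * (D * L) := by
    rw [mul_assoc, ← hpL]; gcongr
  -- The constant is `2608 = 4 (12 + 5·64 + 5·64)`.
  linarith

/-- The contribution of all heavy pairs, under the discrepancy bound and a bound on the degrees. -/
theorem sum_heavy_le {L : ℕ} (hL : 0 < L) {p D : ℝ} (hD : 0 < D)
    (hpD : p * L = D ^ 2) {E F : Finset (Fin m × Fin n)} (hFE : F ⊆ E)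
    (hrow : ∀ i, (#{e ∈ F | e.1 = i} : ℝ) ≤ 2 * D ^ 2)
    (hcol : ∀ j, (#{e ∈ F | e.2 = j} : ℝ) ≤ 2 * D ^ 2)
    {u : Fin m → ℝ} {v : Fin n → ℝ} (hu0 : ∀ i, 0 ≤ u i) (hv0 : ∀ j, 0 ≤ v j)
    (hu : ∑ i, u i ^ 2 ≤ (L : ℝ)) (hv : ∑ j, v j ^ 2 ≤ (L : ℝ))
    (hF : ∀ e ∈ F, D < u e.1 * v e.2)
    (hE : ∀ t < 2 * L, ∀ (A : Finset (Fin m)) (B : Finset (Fin n)),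
      scaleExponent D t * #{e ∈ E | e.1 ∈ A ∧ e.2 ∈ B} ≤
        p * #A * #B * (Real.exp (scaleExponent D t) - 1) +
          5 * (subsetEntropy L #A + subsetEntropy L #B)) :
    ∑ e ∈ F, u e.1 * v e.2 ≤ 2612 * D * L := by
  classical
  have hL0 : (0 : ℝ) < L := by exact_mod_cast hL
  have hpos : ∀ e ∈ F, 0 < u e.1 ∧ 0 < v e.2 := fun e he => by
    have h := hF e he
    constructor
    · rcases (hu0 e.1).eq_or_lt with h0 | h0
      · rw [← h0] at h; linarith
      · exact h0
    · rcases (hv0 e.2).eq_or_lt with h0 | h0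
      · rw [← h0] at h; linarith
      · exact h0
  have h3 := sum_balanced_le hL hD hpD
    (F := {e ∈ F | u e.1 < D * v e.2 ∧ v e.2 < D * u e.1})
    ((filter_subset _ _).trans hFE) hu hv (fun e he => by
      obtain ⟨he, h1, h2⟩ := mem_filter.mp he
      exact ⟨(hpos e he).1, (hpos e he).2, hF e he, h1, h2⟩) hE
  have h1 : ∑ e ∈ F, u e.1 ^ 2 / D ≤ 2 * D * L := by
    calc ∑ e ∈ F, u e.1 ^ 2 / D = ∑ i, ∑ e ∈ F with e.1 = i, u i ^ 2 / D := by
          rw [← Finset.sum_fiberwise_of_maps_to (t := univ) (g := Prod.fst) fun _ _ => mem_univ _]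
          refine Finset.sum_congr rfl fun i _ => Finset.sum_congr rfl fun e he => ?_
          rw [(mem_filter.mp he).2]
      _ = ∑ i, #{e ∈ F | e.1 = i} * (u i ^ 2 / D) := by simp
      _ ≤ ∑ i, 2 * D ^ 2 * (u i ^ 2 / D) := by gcongr with i; exact hrow i
      _ = 2 * D * ∑ i, u i ^ 2 := by
          rw [← Finset.mul_sum, ← Finset.sum_div]; field_simp
      _ ≤ _ := by gcongr
  have h2 : ∑ e ∈ F, v e.2 ^ 2 / D ≤ 2 * D * L := by
    calc ∑ e ∈ F, v e.2 ^ 2 / D = ∑ i, ∑ e ∈ F with e.2 = i, v i ^ 2 / D := by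
          rw [← Finset.sum_fiberwise_of_maps_to (t := univ) (g := Prod.snd) fun _ _ => mem_univ _]
          refine Finset.sum_congr rfl fun i _ => Finset.sum_congr rfl fun e he => ?_
          rw [(mem_filter.mp he).2]
      _ = ∑ i, #{e ∈ F | e.2 = i} * (v i ^ 2 / D) := by simp
      _ ≤ ∑ i, 2 * D ^ 2 * (v i ^ 2 / D) := by gcongr with i; exact hcol i
      _ = 2 * D * ∑ i, v i ^ 2 := by
          rw [← Finset.mul_sum, ← Finset.sum_div]; field_simp
      _ ≤ _ := by gcongr
  -- An unbalanced pair satisfies `u v ≤ u²/D` or `u v ≤ v²/D`. With at most `2D²` pairs of `F` in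
  -- each row and column, these terms add up to `O(D L)`.
  have hall : ∑ e ∈ F, u e.1 * v e.2 ≤ ∑ e ∈ F, (u e.1 ^ 2 / D + v e.2 ^ 2 / D +
      if u e.1 < D * v e.2 ∧ v e.2 < D * u e.1 then u e.1 * v e.2 else 0) := by
    refine Finset.sum_le_sum fun e he => ?_
    obtain ⟨p1, p2⟩ := hpos e he
    have q1 : 0 ≤ u e.1 ^ 2 / D := by positivity
    have q2 : 0 ≤ v e.2 ^ 2 / D := by positivity
    split_ifs with h
    · linarith
    · rw [not_and_or, not_lt, not_lt] at h
      rcases h with h | h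
      · have : u e.1 * v e.2 ≤ u e.1 ^ 2 / D := by
          rw [le_div_iff₀ hD]; nlinarith
        linarith
      · have : u e.1 * v e.2 ≤ v e.2 ^ 2 / D := by
          rw [le_div_iff₀ hD]; nlinarith
        linarith
  rw [Finset.sum_add_distrib, Finset.sum_add_distrib, ← Finset.sum_filter] at hall
  linarith

end RankEstimation

/-! ### The bilinear form of the centered trimmed matrix -/

namespace RankEstimation

variable {m n : ℕ}

/-- The discrepancy property of a set of positions at density `p`: no pair of sets of rows and
columns spans many more positions than expected, up to an entropy term. -/
def HasDiscrepancyBound (E : Finset (Fin m × Fin n)) (L : ℕ) (p D : ℝ) : Prop :=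
  ∀ t < 2 * L, ∀ (A : Finset (Fin m)) (B : Finset (Fin n)),
    scaleExponent D t * #{e ∈ E | e.1 ∈ A ∧ e.2 ∈ B} ≤
      p * #A * #B * (Real.exp (scaleExponent D t) - 1) +
        5 * (subsetEntropy L #A + subsetEntropy L #B)

/-- The light pairs contribute little to the bilinear form of the centered observed matrix. -/
def HasLightBound (E : Finset (Fin m × Fin n)) (M : Matrix (Fin m) (Fin n) ℝ) (L : ℕ) (p D : ℝ) :
    Prop :=
  ∀ u ∈ quarterGrid m L, ∀ v ∈ quarterGrid n L,
    ∑ e ∈ E with e ∈ lightPairs u v D, u e.1 * v e.2 * M e.1 e.2 ≤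
      p * ∑ e ∈ lightPairs u v D, u e.1 * v e.2 * M e.1 e.2 + 40 * L * D

theorem HasDiscrepancyBound.card_le {E : Finset (Fin m × Fin n)} {L : ℕ} {p D : ℝ} (hL : 0 < L)
    (hD : 4 ≤ D) (h : HasDiscrepancyBound E L p D)
    (A : Finset (Fin m)) (B : Finset (Fin n)) :
    (#{e ∈ E | e.1 ∈ A ∧ e.2 ∈ B} : ℝ) ≤ p * #A * #B * (Real.exp 1 - 1) + 10 * L := by
  -- Since `D ≥ 4`, the maximum in the exponent is `1` at scale `0`.
  have h1 : scaleExponent D 0 = 1 := by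
    rw [scaleExponent, max_eq_left, Real.log_one, add_zero]
    rw [div_le_one (by linarith)]; norm_num; exact hD
  have h2 := h 0 (by lia) A B
  rw [h1, one_mul] at h2
  linarith [subsetEntropy_le_size hL #A, subsetEntropy_le_size hL #B]

/-- A set of rows of more than twice the average degree is small. -/
theorem HasDiscrepancyBound.card_rows_le {E : Finset (Fin m × Fin n)} {L : ℕ} {p D : ℝ}
    (hL : 0 < L) (hp : 0 ≤ p) (hD : 4 ≤ D) (h : HasDiscrepancyBound E L p D) {A : Finset (Fin m)}
    (hA : ∀ i ∈ A, 2 * (p * n) ≤ rowDegree E i) : p * #A * n ≤ 36 * L := by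
  have h1 := h.card_le hL hD A univ
  rw [card_univ, Fintype.card_fin] at h1
  have h2 : (#{e ∈ E | e.1 ∈ A ∧ e.2 ∈ (univ : Finset (Fin n))} : ℝ) =
      ∑ i ∈ A, (rowDegree E i : ℝ) := by
    rw [← Nat.cast_sum, Nat.cast_inj,
      Finset.card_eq_sum_card_fiberwise (f := Prod.fst) (t := A) fun e he => by
        simpa using (mem_filter.mp he).2]
    refine Finset.sum_congr rfl fun i hi => ?_
    rw [rowDegree, Finset.filter_filter]
    congr 1
    ext e
    simp only [mem_filter, mem_univ, and_true]
    constructor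
    · rintro ⟨a, -, b⟩; exact ⟨a, b⟩
    · rintro ⟨a, b⟩; exact ⟨a, b ▸ hi, b⟩
  have h3 : ∑ i ∈ A, 2 * (p * n) ≤ ∑ i ∈ A, (rowDegree E i : ℝ) := Finset.sum_le_sum hA
  rw [Finset.sum_const, nsmul_eq_mul] at h3
  -- What matters is `e - 1 < 2`: the excess degree `2 - (e - 1) > 0.28` leaves `p |A| n ≤
  -- 10L/0.28`, below `36L`.
  have h4 : Real.exp 1 - 1 ≤ 1.7183 := by linarith [Real.exp_one_lt_d9]
  have h5 : 0 ≤ p * #A * n := by positivity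
  have h6 := mul_le_mul_of_nonneg_left h4 h5
  have h7 : (0 : ℝ) ≤ L := Nat.cast_nonneg L
  rw [h2] at h1
  nlinarith

theorem HasDiscrepancyBound.card_cols_le {E : Finset (Fin m × Fin n)} {L : ℕ} {p D : ℝ}
    (hL : 0 < L) (hp : 0 ≤ p) (hD : 4 ≤ D) (h : HasDiscrepancyBound E L p D) {B : Finset (Fin n)}
    (hB : ∀ j ∈ B, 2 * (p * m) ≤ colDegree E j) : p * #B * m ≤ 36 * L := by
  have h1 := h.card_le hL hD univ B
  rw [card_univ, Fintype.card_fin] at h1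
  have h2 : (#{e ∈ E | e.1 ∈ (univ : Finset (Fin m)) ∧ e.2 ∈ B} : ℝ) =
      ∑ j ∈ B, (colDegree E j : ℝ) := by
    rw [← Nat.cast_sum, Nat.cast_inj,
      Finset.card_eq_sum_card_fiberwise (f := Prod.snd) (t := B) fun e he => by
        simpa using (mem_filter.mp he).2]
    refine Finset.sum_congr rfl fun i hi => ?_
    rw [colDegree, Finset.filter_filter]
    congr 1
    ext e
    simp only [mem_filter, mem_univ, true_and]
    constructor
    · rintro ⟨a, -, b⟩; exact ⟨a, b⟩
    · rintro ⟨a, b⟩; exact ⟨a, b ▸ hi, b⟩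
  have h3 : ∑ j ∈ B, 2 * (p * m) ≤ ∑ j ∈ B, (colDegree E j : ℝ) := Finset.sum_le_sum hB
  rw [Finset.sum_const, nsmul_eq_mul] at h3
  have h4 : Real.exp 1 - 1 ≤ 1.7183 := by linarith [Real.exp_one_lt_d9]
  have h5 : 0 ≤ p * #B * m := by positivity
  have h6 := mul_le_mul_of_nonneg_left h4 h5
  have h7 : (0 : ℝ) ≤ L := Nat.cast_nonneg L
  rw [h2] at h1
  nlinarith

theorem sum_abs_le_sqrt {k L : ℕ} {u : Fin k → ℝ} (hu : ∑ i, u i ^ 2 ≤ (L : ℝ))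
    (A : Finset (Fin k)) : ∑ i ∈ A, |u i| ≤ √(#A * L) := by
  refine Real.le_sqrt_of_sq_le ?_
  calc (∑ i ∈ A, |u i|) ^ 2 ≤ #A * ∑ i ∈ A, |u i| ^ 2 := sq_sum_le_card_mul_sum_sq
    _ ≤ #A * ∑ i, u i ^ 2 := by
        gcongr
        simp only [sq_abs]
        exact Finset.sum_le_sum_of_subset_of_nonneg (subset_univ _) fun _ _ _ => sq_nonneg _
    _ ≤ _ := by gcongr

/-- The bilinear form of a matrix with entries bounded by `1`, restricted to a rectangle. -/
theorem sum_rectangle_le {L : ℕ} {u : Fin m → ℝ} {v : Fin n → ℝ}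
    (hu : ∑ i, u i ^ 2 ≤ (L : ℝ)) (hv : ∑ j, v j ^ 2 ≤ (L : ℝ)) (A : Finset (Fin m))
    (B : Finset (Fin n)) {p D : ℝ} (hp : 0 ≤ p) (hD : 0 ≤ D) (hpD : p * L = D ^ 2)
    (hAB : p * #A * #B ≤ 36 * L) :
    p * ∑ e ∈ A ×ˢ B, |u e.1 * v e.2| ≤ 6 * L * D := by
  have h1 : ∑ e ∈ A ×ˢ B, |u e.1 * v e.2| = (∑ i ∈ A, |u i|) * ∑ j ∈ B, |v j| := by
    rw [Finset.sum_product, Finset.sum_mul_sum]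
    simp only [abs_mul]
  have h2 : p * ∑ e ∈ A ×ˢ B, |u e.1 * v e.2| ≤ p * (√(#A * L) * √(#B * L)) := by
    rw [h1]
    gcongr
    · exact sum_abs_le_sqrt hu A
    · exact sum_abs_le_sqrt hv B
  refine h2.trans (le_of_sq_le_sq ?_ (by positivity))
  rw [mul_pow, mul_pow, Real.sq_sqrt (by positivity), Real.sq_sqrt (by positivity)]
  calc p ^ 2 * (#A * L * (#B * L)) = (p * #A * #B) * (p * L) * L := by ring
    _ ≤ (36 * L) * (p * L) * L := by gcongr
    _ = _ := by rw [hpD]; ring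

/-- On heavy pairs `|x| ≤ x²/D`, and the squares add up to at most `L²`. So the heavy pairs carry
little of the mean even though they may dominate the random sum. -/
theorem mul_sum_heavy_le {L : ℕ} {u : Fin m → ℝ} {v : Fin n → ℝ}
    (hu : ∑ i, u i ^ 2 ≤ (L : ℝ)) (hv : ∑ j, v j ^ 2 ≤ (L : ℝ)) {p D : ℝ} (hp : 0 ≤ p)
    (hD : 0 < D) (hpD : p * L = D ^ 2) :
    p * ∑ e with e ∉ lightPairs u v D, |u e.1 * v e.2| ≤ L * D := by
  have h1 : ∑ e with e ∉ lightPairs u v D, |u e.1 * v e.2| ≤ L * L / D := by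
    calc _ ≤ ∑ e with e ∉ lightPairs u v D, (u e.1 * v e.2) ^ 2 / D := by
          refine Finset.sum_le_sum fun e he => ?_
          have h : D < |u e.1 * v e.2| := by
            have := (mem_filter.mp he).2
            rw [lightPairs, mem_filter, not_and, not_le] at this
            exact this (mem_univ _)
          rw [le_div_iff₀ hD, ← sq_abs (u e.1 * v e.2)]
          nlinarith
      _ ≤ ∑ e : Fin m × Fin n, (u e.1 * v e.2) ^ 2 / D :=
          Finset.sum_le_sum_of_subset_of_nonneg (filter_subset _ _) fun _ _ _ => by positivity
      _ = (∑ i, u i ^ 2) * (∑ j, v j ^ 2) / D := by rw [← Finset.sum_div, sum_prod_sq]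
      _ ≤ _ := by gcongr
  calc _ ≤ p * (L * L / D) := by gcongr
    _ = (p * L) * L / D := by ring
    _ = _ := by rw [hpD]; field_simp

theorem mem_quarterGrid_restrict {L : ℕ} {u : Fin m → ℝ} (hu : u ∈ quarterGrid m L)
    (P : Fin m → Prop) [DecidablePred P] :
    (fun i => if P i then u i else 0) ∈ quarterGrid m L := by
  rw [mem_quarterGrid] at hu ⊢
  refine ⟨fun i => ?_, le_trans (Finset.sum_le_sum fun i _ => ?_) hu.2⟩
  · by_cases h : P i
    · simpa [h] using hu.1 i
    · exact ⟨0, by simp [h]⟩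
  · split_ifs <;> nlinarith [sq_nonneg (u i)]

/-- Deterministic once the discrepancy and light bounds hold. The trimming depends on `E`, but it
can be moved from the matrix to the vectors, and the light bound is uniform over the grid. -/
theorem sum_quadratic_trimmed_sub_le {s L : ℕ} (hL : 0 < L) (hmL : m ≤ L) (hnL : n ≤ L)
    (hm : 0 < m) (hn : 0 < n)
    {p D : ℝ} (hp : p = (s : ℝ) / (m * n)) (hD : 4 ≤ D) (hpD : p * L = D ^ 2)
    {E : Finset (Fin m × Fin n)} (hE : #E = s) {M : Matrix (Fin m) (Fin n) ℝ}
    (hM : ∀ i j, |M i j| ≤ 1) (hdisc : HasDiscrepancyBound E L p D)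
    (hlight : HasLightBound E M L p D)
    {u : Fin m → ℝ} {v : Fin n → ℝ} (hu : u ∈ quarterGrid m L) (hv : v ∈ quarterGrid n L) :
    ∑ e : Fin m × Fin n, u e.1 * v e.2 * (trimmed M E e.1 e.2 - p * M e.1 e.2) ≤
      2665 * L * D := by
  classical
  have hD0 : 0 < D := by linarith
  have hm0 : (0 : ℝ) < m := by exact_mod_cast hm
  have hn0 : (0 : ℝ) < n := by exact_mod_cast hn
  have hp0 : 0 ≤ p := by rw [hp]; positivity
  have hrowavg : 2 * (#E : ℝ) / m = 2 * (p * n) := by rw [hE, hp]; field_simp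
  have hcolavg : 2 * (#E : ℝ) / n = 2 * (p * m) := by rw [hE, hp]; field_simp
  set G : Fin m → Prop := fun i => (rowDegree E i : ℝ) ≤ 2 * (p * n) with hG
  set H : Fin n → Prop := fun j => (colDegree E j : ℝ) ≤ 2 * (p * m) with hH
  -- Deleting the rows and columns of large degree amounts to setting the corresponding coordinates
  -- of `u` and `v` to `0`; the grid is closed under this.
  set u' : Fin m → ℝ := fun i => if G i then u i else 0 with hu'
  set v' : Fin n → ℝ := fun j => if H j then v j else 0 with hv'
  have hu'g : u' ∈ quarterGrid m L := mem_quarterGrid_restrict hu G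
  have hv'g : v' ∈ quarterGrid n L := mem_quarterGrid_restrict hv H
  have hu2 := (mem_quarterGrid.mp hu).2
  have hv2 := (mem_quarterGrid.mp hv).2
  have hu'2 := (mem_quarterGrid.mp hu'g).2
  have hv'2 := (mem_quarterGrid.mp hv'g).2
  have htrim : ∀ e : Fin m × Fin n, u e.1 * v e.2 * trimmed M E e.1 e.2 =
      if e ∈ E then u' e.1 * v' e.2 * M e.1 e.2 else 0 := by
    intro e
    simp only [trimmed, observed, Matrix.of_apply, hrowavg, hcolavg, hu', hv', hG, hH]
    by_cases h1 : (rowDegree E e.1 : ℝ) ≤ 2 * (p * n) <;>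
      by_cases h2 : (colDegree E e.2 : ℝ) ≤ 2 * (p * m) <;>
      by_cases h3 : e ∈ E <;> simp [h1, h2, h3, not_lt, not_le.mp]
  -- the observed entries, split into light and heavy pairs
  have h1 : ∑ e : Fin m × Fin n, u e.1 * v e.2 * trimmed M E e.1 e.2 =
      ∑ e ∈ E with e ∈ lightPairs u' v' D, u' e.1 * v' e.2 * M e.1 e.2 +
      ∑ e ∈ E with e ∉ lightPairs u' v' D, u' e.1 * v' e.2 * M e.1 e.2 := by
    rw [Finset.sum_filter_add_sum_filter_not, Finset.sum_congr rfl fun e _ => htrim e,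
      Finset.sum_ite_mem, univ_inter]
  have hMle : ∀ (a : ℝ) (i : Fin m) (j : Fin n), |a * M i j| ≤ |a| := fun a i j => by
    rw [abs_mul]; exact mul_le_of_le_one_right (abs_nonneg _) (hM i j)
  have hheavy : ∑ e ∈ E with e ∉ lightPairs u' v' D, u' e.1 * v' e.2 * M e.1 e.2 ≤
      2612 * D * L := by
    have hF : ∀ e ∈ ({e ∈ E | e ∉ lightPairs u' v' D} : Finset _), D < |u' e.1| * |v' e.2| := by
      intro e he
      have := (mem_filter.mp he).2
      rw [lightPairs, mem_filter, not_and, not_le, abs_mul] at this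
      exact this (mem_univ _)
    refine le_trans (Finset.sum_le_sum fun e _ => (le_abs_self _).trans
      ((hMle _ _ _).trans_eq (abs_mul _ _))) (sum_heavy_le hL hD0 hpD (filter_subset _ E)
      (fun i => ?_) (fun j => ?_) (u := fun i => |u' i|) (v := fun j => |v' j|)
      (fun i => abs_nonneg _) (fun j => abs_nonneg _) (by simpa using hu'2) (by simpa using hv'2)
      hF hdisc)
    · have hpn : 2 * (p * n) ≤ 2 * D ^ 2 := by rw [← hpD]; gcongr
      rcases (Finset.eq_empty_or_nonempty
        {e ∈ ({e ∈ E | e ∉ lightPairs u' v' D} : Finset _) | e.1 = i}) with h | ⟨e, he⟩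
      · rw [h]; simp; positivity
      · obtain ⟨he, hi⟩ := mem_filter.mp he
        have hGi : G i := by
          by_contra hGi
          have := hF e he
          rw [hi] at this
          simp [hu', hGi] at this
          linarith
        refine le_trans ?_ (hGi.trans hpn)
        rw [Nat.cast_le, rowDegree]
        exact card_le_card (filter_subset_filter _ (filter_subset _ _))
    · have hpn : 2 * (p * m) ≤ 2 * D ^ 2 := by rw [← hpD]; gcongr
      rcases (Finset.eq_empty_or_nonempty
        {e ∈ ({e ∈ E | e ∉ lightPairs u' v' D} : Finset _) | e.2 = j}) with h | ⟨e, he⟩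
      · rw [h]; simp; positivity
      · obtain ⟨he, hi⟩ := mem_filter.mp he
        have hHj : H j := by
          by_contra hHj
          have := hF e he
          rw [hi] at this
          simp [hv', hHj] at this
          linarith
        refine le_trans ?_ (hHj.trans hpn)
        rw [Nat.cast_le, colDegree]
        exact card_le_card (filter_subset_filter _ (filter_subset _ _))
  have hl := hlight u' hu'g v' hv'g
  -- the light pairs carry almost all of the mean
  have hmean : ∑ e ∈ lightPairs u' v' D, u' e.1 * v' e.2 * M e.1 e.2 =
      ∑ e : Fin m × Fin n, u' e.1 * v' e.2 * M e.1 e.2 -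
      ∑ e with e ∉ lightPairs u' v' D, u' e.1 * v' e.2 * M e.1 e.2 := by
    rw [eq_sub_iff_add_eq, ← Finset.sum_filter_add_sum_filter_not univ (· ∈ lightPairs u' v' D)]
    congr 1
    exact Finset.sum_congr (by ext; simp) fun _ _ => rfl
  have hmh : -(p * ∑ e with e ∉ lightPairs u' v' D, u' e.1 * v' e.2 * M e.1 e.2) ≤ L * D := by
    refine le_trans ?_ (mul_sum_heavy_le hu'2 hv'2 hp0 hD0 hpD)
    rw [← mul_neg, ← Finset.sum_neg_distrib]
    gcongr with e
    exact (neg_le_abs _).trans (hMle _ _ _)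
  -- the trimmed rows and columns carry almost none of it
  have hrest : p * ∑ e : Fin m × Fin n, (u' e.1 * v' e.2 * M e.1 e.2 - u e.1 * v e.2 * M e.1 e.2) ≤
      12 * L * D := by
    have hr : p * #({i | ¬ G i} : Finset (Fin m)) * n ≤ 36 * L :=
      hdisc.card_rows_le hL hp0 hD fun i hi => (not_le.mp (mem_filter.mp hi).2).le
    have hc : p * #({j | ¬ H j} : Finset (Fin n)) * m ≤ 36 * L :=
      hdisc.card_cols_le hL hp0 hD fun i hi => (not_le.mp (mem_filter.mp hi).2).le
    have r1 := sum_rectangle_le hu2 hv2 ({i | ¬ G i} : Finset (Fin m)) univ hp0 hD0.le hpD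
      (by simpa using hr)
    have r2 := sum_rectangle_le hu2 hv2 univ ({j | ¬ H j} : Finset (Fin n)) hp0 hD0.le hpD
      (by simpa [mul_right_comm] using hc)
    have : ∑ e : Fin m × Fin n, (u' e.1 * v' e.2 * M e.1 e.2 - u e.1 * v e.2 * M e.1 e.2) ≤
        ∑ e ∈ ({i | ¬ G i} : Finset (Fin m)) ×ˢ univ, |u e.1 * v e.2| +
        ∑ e ∈ univ ×ˢ ({j | ¬ H j} : Finset (Fin n)), |u e.1 * v e.2| := by
      have e1 : ∀ S : Finset (Fin m × Fin n), ∑ e ∈ S, |u e.1 * v e.2| =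
          ∑ e, if e ∈ S then |u e.1 * v e.2| else 0 := fun S => by
        rw [Finset.sum_ite_mem, univ_inter]
      rw [e1, e1, ← Finset.sum_add_distrib]
      refine Finset.sum_le_sum fun e _ => ?_
      have h := neg_le_abs (u e.1 * v e.2 * M e.1 e.2)
      have h' := hMle (u e.1 * v e.2) e.1 e.2
      have h'' := abs_nonneg (u e.1 * v e.2)
      simp only [mem_product, mem_filter, mem_univ, true_and, and_true, hu', hv']
      by_cases hGe : G e.1 <;> by_cases hHe : H e.2 <;>
        simp [hGe, hHe, -abs_mul] <;> linarith
    have := mul_le_mul_of_nonneg_left this hp0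
    rw [mul_add] at this
    linarith
  have hsplit : ∑ e : Fin m × Fin n, u e.1 * v e.2 * (trimmed M E e.1 e.2 - p * M e.1 e.2) =
      ∑ e : Fin m × Fin n, u e.1 * v e.2 * trimmed M E e.1 e.2 -
      p * ∑ e : Fin m × Fin n, u e.1 * v e.2 * M e.1 e.2 := by
    rw [Finset.mul_sum, ← Finset.sum_sub_distrib]
    exact Finset.sum_congr rfl fun e _ => by ring
  rw [Finset.sum_sub_distrib, mul_sub] at hrest
  rw [hmean, mul_sub] at hl
  rw [hsplit, h1]
  -- The constant is `2665 = 40 + 2612 + 1 + 12`: light pairs, heavy pairs, mean on heavy pairs,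
  -- mean on trimmed rows and columns.
  linarith

end RankEstimation

/-! ### From the grid to the operator norm -/

namespace RankEstimation

variable {m n : ℕ}

/-- Rounding is toward zero, so that a rounded vector is no longer than the original and stays in
the grid. -/
theorem exists_int_quarter_near (w : ℝ) : ∃ z : ℤ, |(z : ℝ) / 4| ≤ |w| ∧ |w - z / 4| ≤ 1 / 4 := by
  rcases le_total 0 w with h | h
  · refine ⟨⌊4 * w⌋, ?_, ?_⟩
    · have h1 : (0 : ℝ) ≤ ⌊4 * w⌋ := by exact_mod_cast Int.floor_nonneg.mpr (by linarith)
      rw [abs_of_nonneg (by positivity), abs_of_nonneg h]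
      linarith [Int.floor_le (4 * w)]
    · rw [abs_le]
      constructor <;> linarith [Int.floor_le (4 * w), Int.lt_floor_add_one (4 * w)]
  · refine ⟨⌈4 * w⌉, ?_, ?_⟩
    · have h1 : (⌈4 * w⌉ : ℝ) ≤ 0 := by
        exact_mod_cast Int.ceil_le.mpr (by push_cast; linarith)
      rw [abs_of_nonpos (by linarith), abs_of_nonpos h]
      linarith [Int.le_ceil (4 * w)]
    · rw [abs_le]
      constructor <;> linarith [Int.le_ceil (4 * w), Int.ceil_lt_add_one (4 * w)]

theorem exists_quarterGrid_near {k L : ℕ} (hk : k ≤ L) (w : EuclideanSpace ℝ (Fin k))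
    (hw : ‖w‖ ^ 2 ≤ L) : ∃ u : EuclideanSpace ℝ (Fin k), (u : Fin k → ℝ) ∈ quarterGrid k L ∧
      ‖u‖ ^ 2 ≤ L ∧ ‖w - u‖ ≤ √L / 4 := by
  choose z hz1 hz2 using fun i => exists_int_quarter_near (w i)
  set u : EuclideanSpace ℝ (Fin k) := WithLp.toLp 2 fun i => (z i : ℝ) / 4 with hu
  have hu1 : ‖u‖ ^ 2 ≤ L := by
    refine le_trans ?_ hw
    rw [EuclideanSpace.norm_sq_eq, EuclideanSpace.norm_sq_eq]
    refine Finset.sum_le_sum fun i _ => pow_le_pow_left₀ (norm_nonneg _) ?_ 2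
    rw [Real.norm_eq_abs, Real.norm_eq_abs]
    exact hz1 i
  refine ⟨u, mem_quarterGrid.mpr ⟨fun i => ⟨z i, rfl⟩, ?_⟩, hu1, ?_⟩
  · rw [EuclideanSpace.norm_sq_eq] at hu1
    simpa using hu1
  · refine le_of_sq_le_sq ?_ (by positivity)
    rw [EuclideanSpace.norm_sq_eq, div_pow, Real.sq_sqrt (by positivity)]
    calc ∑ i, ‖(w - u) i‖ ^ 2 ≤ ∑ i : Fin k, (1 / 4 : ℝ) ^ 2 := by
          refine Finset.sum_le_sum fun i _ => pow_le_pow_left₀ (norm_nonneg _) ?_ 2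
          simpa [hu] using hz2 i
      _ = k / 4 ^ 2 := by simp; ring
      _ ≤ _ := by gcongr

theorem inner_toEuclideanLin (B : Matrix (Fin m) (Fin n) ℝ) (x : EuclideanSpace ℝ (Fin m))
    (y : EuclideanSpace ℝ (Fin n)) :
    inner ℝ x (Matrix.toEuclideanLin B y) =
      ∑ e : Fin m × Fin n, x e.1 * y e.2 * B e.1 e.2 := by
  rw [Fintype.sum_prod_type, PiLp.inner_apply]
  refine Finset.sum_congr rfl fun i _ => ?_
  simp only [Matrix.ofLp_toLpLin, Matrix.toLin'_apply, Matrix.mulVec, dotProduct]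
  simp only [RCLike.inner_apply, conj_trivial, Finset.sum_mul]
  exact Finset.sum_congr rfl fun j _ => by ring

/-- The operator norm is controlled by the bilinear form on the grid. -/
theorem norm_toEuclideanLin_le_of_grid {L : ℕ} (hL : 0 < L) (hmL : m ≤ L) (hnL : n ≤ L)
    (B : Matrix (Fin m) (Fin n) ℝ) {S : ℝ} (hS : 0 ≤ S)
    (h : ∀ u ∈ quarterGrid m L, ∀ v ∈ quarterGrid n L,
      ∑ e : Fin m × Fin n, u e.1 * v e.2 * B e.1 e.2 ≤ S) (y : EuclideanSpace ℝ (Fin n)) :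
    ‖Matrix.toEuclideanLin B y‖ ≤ 2 * S / L * ‖y‖ := by
  have hL0 : (0 : ℝ) < L := by exact_mod_cast hL
  set f := LinearMap.toContinuousLinearMap (Matrix.toEuclideanLin B) with hf
  have hfa : ∀ y, f y = Matrix.toEuclideanLin B y := fun y => rfl
  -- Both vectors have length at most `√L` and are rounded with error at most `√L/4`; each rounding
  -- costs `‖f‖ L / 4`.
  have hbil : ∀ x y, ‖x‖ ^ 2 ≤ L → ‖y‖ ^ 2 ≤ L → inner ℝ x (f y) ≤ S + ‖f‖ * L / 2 := by
    intro x y hx hy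
    obtain ⟨u, hu, hu2, hxu⟩ := exists_quarterGrid_near hmL x hx
    obtain ⟨v, hv, hv2, hyv⟩ := exists_quarterGrid_near hnL y hy
    have hle : ∀ (a : EuclideanSpace ℝ (Fin m)) (b : EuclideanSpace ℝ (Fin n)) (α β : ℝ),
        ‖a‖ ≤ α → ‖b‖ ≤ β → inner ℝ a (f b) ≤ ‖f‖ * (α * β) := by
      intro a b α β ha hb
      calc inner ℝ a (f b) ≤ ‖a‖ * ‖f b‖ := real_inner_le_norm _ _
        _ ≤ ‖a‖ * (‖f‖ * ‖b‖) := by gcongr; exact f.le_opNorm b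
        _ = ‖f‖ * (‖a‖ * ‖b‖) := by ring
        _ ≤ _ := by
          have := (norm_nonneg a).trans ha
          gcongr
    have hy' : ‖y‖ ≤ √L := Real.le_sqrt_of_sq_le hy
    have hu' : ‖u‖ ≤ √L := Real.le_sqrt_of_sq_le hu2
    have hsq : √(L : ℝ) * √L = L := Real.mul_self_sqrt hL0.le
    have h1 := hle (x - u) y _ _ hxu hy'
    have h2 := hle u (y - v) _ _ hu' hyv
    have h3 : inner ℝ u (f v) ≤ S := by
      rw [hfa, inner_toEuclideanLin]; exact h u hu v hv
    have h4 : inner ℝ x (f y) = inner ℝ (x - u) (f y) + inner ℝ u (f (y - v)) +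
        inner ℝ u (f v) := by
      rw [inner_sub_left, map_sub, inner_sub_right]; ring
    have h5 : ‖f‖ * (√L / 4 * √L) = ‖f‖ * L / 4 := by
      rw [div_mul_eq_mul_div, hsq]; ring
    have h6 : ‖f‖ * (√L * (√L / 4)) = ‖f‖ * L / 4 := by
      rw [mul_div_assoc', hsq]; ring
    rw [h4]
    linarith
  -- Test the bilinear form on `f y` and `y`, both rescaled to length `√L`. Half of the norm can
  -- then be absorbed on the left.
  have hnorm : ‖f‖ ≤ S / L + ‖f‖ / 2 := by
    refine f.opNorm_le_bound (by positivity) fun y => ?_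
    rcases eq_or_ne (f y) 0 with h0 | h0
    · rw [h0, norm_zero]; positivity
    have hy0 : y ≠ 0 := by rintro rfl; simp at h0
    have hfy : 0 < ‖f y‖ := norm_pos_iff.mpr h0
    have hy : 0 < ‖y‖ := norm_pos_iff.mpr hy0
    have hn : ∀ {V : Type} [NormedAddCommGroup V] [NormedSpace ℝ V] (w : V), 0 < ‖w‖ →
        ‖(√L / ‖w‖) • w‖ ^ 2 ≤ L := by
      intro V _ _ w hw
      rw [norm_smul, norm_div, norm_norm, Real.norm_of_nonneg (Real.sqrt_nonneg _),
        div_mul_cancel₀ _ hw.ne', Real.sq_sqrt hL0.le]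
    have h1 := hbil ((√L / ‖f y‖) • f y) ((√L / ‖y‖) • y) (hn _ hfy) (hn _ hy)
    rw [map_smul, real_inner_smul_left, real_inner_smul_right, real_inner_self_eq_norm_sq] at h1
    have h2 : √L / ‖f y‖ * (√L / ‖y‖ * ‖f y‖ ^ 2) = L * (‖f y‖ / ‖y‖) := by
      rw [← Real.mul_self_sqrt hL0.le, Real.sqrt_mul_self (Real.sqrt_nonneg _)]
      field_simp
    rw [h2] at h1
    rw [← div_le_iff₀ hy]
    refine le_of_mul_le_mul_left (h1.trans_eq ?_) hL0
    field_simp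
  have hfin : ‖f‖ ≤ 2 * S / L := by rw [mul_div_assoc]; linarith
  calc ‖f y‖ ≤ ‖f‖ * ‖y‖ := f.le_opNorm y
    _ ≤ _ := by gcongr

theorem powersetCard_card_pos {s : ℕ} (hs : s ≤ m * n) :
    (0 : ℝ) < #(powersetCard s (univ : Finset (Fin m × Fin n))) := by
  rw [card_powersetCard, card_univ]
  have := Nat.choose_pos (n := Fintype.card (Fin m × Fin n)) (k := s) (by simpa using hs)
  exact_mod_cast this

theorem uniformProb_ge_of_card_not_le {s : ℕ} (hs : s ≤ m * n)
    {P : Finset (Fin m × Fin n) → Prop} [DecidablePred fun E => ¬ P E] {c : ℝ}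
    (h : (#{E ∈ powersetCard s (univ : Finset (Fin m × Fin n)) | ¬ P E} : ℝ) ≤
      c * #(powersetCard s (univ : Finset (Fin m × Fin n)))) :
    1 - c ≤ uniformProb m n s P := by
  classical
  have h0 := powersetCard_card_pos hs
  rw [uniformProb, le_div_iff₀ h0]
  have h1 := Finset.card_filter_add_card_filter_not (s := powersetCard s
    (univ : Finset (Fin m × Fin n))) P
  have h2 : (#{E ∈ powersetCard s (univ : Finset (Fin m × Fin n)) | P E} : ℝ) +
      #{E ∈ powersetCard s (univ : Finset (Fin m × Fin n)) | ¬ P E} =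
      #(powersetCard s (univ : Finset (Fin m × Fin n))) := by
    rw [← h1]; push_cast; congr!
  have h3 : (#{E ∈ powersetCard s (univ : Finset (Fin m × Fin n)) | P E} : ℝ) =
      #(@Finset.filter _ P (fun E => Classical.propDecidable (P E))
        (powersetCard s (univ : Finset (Fin m × Fin n)))) := by
    congr!
  rw [← h3]
  linarith

theorem uniformProb_mono {s : ℕ} {P Q : Finset (Fin m × Fin n) → Prop}
    (h : ∀ E, #E = s → P E → Q E) : uniformProb m n s P ≤ uniformProb m n s Q := by
  classical
  unfold uniformProb
  gcongr ((?_ : ℕ) : ℝ) / _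
  refine card_le_card fun E hE => ?_
  rw [mem_filter] at hE ⊢
  exact ⟨hE.1, h E (mem_powersetCard.mp hE.1).2 hE.2⟩

theorem trimmed_smul (c : ℝ) (M : Matrix (Fin m) (Fin n) ℝ) (E : Finset (Fin m × Fin n)) :
    trimmed (c • M) E = c • trimmed M E := by
  ext i j
  simp only [trimmed, observed, Matrix.of_apply, Matrix.smul_apply, smul_eq_mul]
  split_ifs <;> simp

/-- The trimmed observed matrix is close in operator norm to its mean. -/
theorem uniformProb_norm_trimmed_sub_ge {s L : ℕ} (hs : s ≤ m * n) (hm : 0 < m) (hn : 0 < n)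
    (hL : L = max m n) {p : ℝ} (hp : p = (s : ℝ) / (m * n)) (hd : 16 ≤ p * L)
    (M : Matrix (Fin m) (Fin n) ℝ) {b : ℝ} (hb : 0 < b) (hM : ∀ i j, |M i j| ≤ b) :
    1 - 6 / (L : ℝ) ≤ uniformProb m n s fun E => ∀ x : EuclideanSpace ℝ (Fin n),
      ‖Matrix.toEuclideanLin (trimmed M E - p • M) x‖ ≤ 5330 * b * √(p * L) * ‖x‖ := by
  classical
  have hmL : m ≤ L := hL ▸ le_max_left _ _
  have hnL : n ≤ L := hL ▸ le_max_right _ _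
  have hLpos : 0 < L := hm.trans_le hmL
  have hL1 : (1 : ℝ) ≤ L := by exact_mod_cast hLpos
  set D := √(p * L) with hD
  have hpD : p * L = D ^ 2 := (Real.sq_sqrt (by linarith)).symm
  have hD4 : 4 ≤ D := Real.le_sqrt_of_sq_le (by norm_num; exact hd)
  -- The estimates assume entries of size at most `1`; trimming commutes with scaling.
  set M' : Matrix (Fin m) (Fin n) ℝ := b⁻¹ • M with hM'
  have hMb : M = b • M' := by rw [hM', smul_smul, mul_inv_cancel₀ hb.ne', one_smul]
  have hM'1 : ∀ i j, |M' i j| ≤ 1 := fun i j => by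
    rw [hM', Matrix.smul_apply, smul_eq_mul, abs_mul, abs_of_pos (inv_pos.mpr hb),
      inv_mul_le_iff₀ hb, mul_one]
    exact hM i j
  have key : 1 - 6 / (L : ℝ) ≤ uniformProb m n s fun E =>
      HasDiscrepancyBound E L p D ∧ HasLightBound E M' L p D := by
    apply uniformProb_ge_of_card_not_le hs
    set Ω := powersetCard s (univ : Finset (Fin m × Fin n)) with hΩ
    have h1 := card_light_deviation_le hs hmL hnL hLpos hp rfl (by linarith) M' hM'1
    have h2 := card_discrepancy_le hs hmL hnL hLpos hp
      ((range (2 * L)).image (scaleExponent D)) fun φ hφ => by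
        obtain ⟨t, -, rfl⟩ := mem_image.mp hφ
        linarith [one_le_scaleExponent D t]
    rw [← hΩ] at h1 h2
    have h3 : (#((range (2 * L)).image (scaleExponent D)) : ℝ) ≤ 2 * L := by
      have := card_image_le (s := range (2 * L)) (f := scaleExponent D)
      rw [card_range] at this
      exact_mod_cast this
    have h4 : (L ^ 2 + 1) * Real.exp (-(3 * L)) ≤ 2 / (L : ℝ) := by
      have h5 : Real.exp (-(3 * (L : ℝ))) ≤ 1 / (L : ℝ) ^ 3 := by
        rw [Real.exp_neg, ← one_div]
        gcongr
        rw [show (3 * (L : ℝ)) = ((3 : ℕ) : ℝ) * L by norm_num, Real.exp_nat_mul]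
        gcongr
        linarith [Real.add_one_le_exp (L : ℝ)]
      calc (L ^ 2 + 1) * Real.exp (-(3 * L)) ≤ ((L : ℝ) ^ 2 + L ^ 2) * (1 / (L : ℝ) ^ 3) := by
            gcongr
            exact one_le_pow₀ hL1
        _ = _ := by field_simp; norm_num
    have h6 : 2 * (L : ℝ) * ((L ^ 2 + 1) / (L : ℝ) ^ 6) ≤ 4 / L := by
      calc 2 * (L : ℝ) * ((L ^ 2 + 1) / (L : ℝ) ^ 6) ≤
            2 * (L : ℝ) * ((L ^ 2 + L ^ 2) / (L : ℝ) ^ 6) := by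
            gcongr
            exact one_le_pow₀ hL1
        _ = 4 / (L : ℝ) ^ 3 := by field_simp; norm_num
        _ ≤ 4 / L := by
            gcongr
            exact le_self_pow₀ hL1 (by norm_num)
    have h7 : (#{E ∈ Ω | ¬ (HasDiscrepancyBound E L p D ∧ HasLightBound E M' L p D)} : ℝ) ≤
        2 * L * ((L ^ 2 + 1) / (L : ℝ) ^ 6) * #Ω +
          (L ^ 2 + 1) * Real.exp (-(3 * L)) * #Ω := by
      have h8 := h2.trans (mul_le_mul_of_nonneg_right
        (mul_le_mul_of_nonneg_right h3 (by positivity)) (Nat.cast_nonneg #Ω))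
      refine le_trans ?_ (add_le_add h8 h1)
      rw [← Nat.cast_add, Nat.cast_le]
      refine (card_le_card fun E hE => ?_).trans (card_union_le _ _)
      obtain ⟨hEΩ, hE⟩ := mem_filter.mp hE
      rw [mem_union, mem_filter, mem_filter]
      rw [not_and_or] at hE
      rcases hE with hE | hE
      · left
        refine ⟨hEΩ, ?_⟩
        unfold HasDiscrepancyBound at hE
        push Not at hE
        obtain ⟨t, ht, A, B, hAB⟩ := hE
        exact ⟨⟨scaleExponent D t, A, B⟩, mem_product.mpr
          ⟨mem_image_of_mem _ (mem_range.mpr ht), mem_univ _⟩, hAB⟩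
      · right
        refine ⟨hEΩ, ?_⟩
        unfold HasLightBound at hE
        push Not at hE
        obtain ⟨u, hu, v, hv, huv⟩ := hE
        exact ⟨(u, v), mem_product.mpr ⟨hu, hv⟩, huv.le⟩
    refine h7.trans ?_
    rw [← add_mul]
    refine mul_le_mul_of_nonneg_right ?_ (Nat.cast_nonneg _)
    calc _ ≤ 4 / (L : ℝ) + 2 / L := add_le_add h6 h4
      _ = _ := by ring
  refine key.trans (uniformProb_mono fun E hE h x => ?_)
  have hgrid := norm_toEuclideanLin_le_of_grid hLpos hmL hnL (trimmed M' E - p • M')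
    (S := 2665 * L * D) (by positivity) (fun u hu v hv => by
      simpa using sum_quadratic_trimmed_sub_le hLpos hmL hnL hm hn hp hD4 hpD hE hM'1 h.1 h.2
        hu hv) x
  have hs : trimmed M E - p • M = b • (trimmed M' E - p • M') := by
    rw [hMb, trimmed_smul, smul_sub, smul_comm]
  rw [hs, map_smul, LinearMap.smul_apply, norm_smul, Real.norm_of_nonneg hb.le]
  calc b * ‖Matrix.toEuclideanLin (trimmed M' E - p • M') x‖
      ≤ b * (2 * (2665 * L * D) / L * ‖x‖) := by gcongr
    _ = _ := by field_simp; ring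

end RankEstimation

/-! ### From the norm bound to the rank -/

namespace RankEstimation

variable {m n : ℕ}

theorem sv_trimmed_le {M : Matrix (Fin m) (Fin n) ℝ} {E : Finset (Fin m × Fin n)} {p c : ℝ}
    (hp : 0 < p) (hc : 0 ≤ c)
    (h : ∀ x, ‖Matrix.toEuclideanLin (trimmed M E - p • M) x‖ ≤ c * ‖x‖) (i : ℕ) :
    sv (trimmed M E) i ≤ p * sv M i + c := by
  refine sv_le_of_norm_le _ _ hp.le hc (fun x => ?_) i
  have h1 := h x
  rw [map_sub, map_smul, LinearMap.sub_apply, LinearMap.smul_apply] at h1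
  have h2 := norm_le_norm_add_norm_sub' (Matrix.toEuclideanLin (trimmed M E) x)
    (p • Matrix.toEuclideanLin M x)
  rw [norm_smul, Real.norm_of_nonneg hp.le] at h2
  linarith

theorem mul_sv_le_sv_trimmed {M : Matrix (Fin m) (Fin n) ℝ} {E : Finset (Fin m × Fin n)}
    {p c : ℝ} (hp : 0 < p) (hc : 0 ≤ c)
    (h : ∀ x, ‖Matrix.toEuclideanLin (trimmed M E - p • M) x‖ ≤ c * ‖x‖) (i : ℕ) :
    p * sv M i ≤ sv (trimmed M E) i + c := by
  have := sv_le_of_norm_le M (trimmed M E) (p := p⁻¹) (c := p⁻¹ * c) (by positivity)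
    (by positivity) (fun x => ?_) i
  · calc p * sv M i ≤ p * (p⁻¹ * sv (trimmed M E) i + p⁻¹ * c) := by gcongr
      _ = _ := by field_simp
  · have h1 := h x
    rw [map_sub, map_smul, LinearMap.sub_apply, LinearMap.smul_apply] at h1
    have h2 := norm_le_norm_add_norm_sub' (p • Matrix.toEuclideanLin M x)
      (Matrix.toEuclideanLin (trimmed M E) x)
    rw [norm_smul, Real.norm_of_nonneg hp.le, norm_sub_rev] at h2
    rw [mul_assoc, ← mul_add, ← div_eq_inv_mul, le_div_iff₀ hp]
    linarith

/-- If the trimmed observed matrix is close to its mean, then the rank minimizes the cost. -/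
theorem estimatesRank_of_norm_sub_le {M : Matrix (Fin m) (Fin n) ℝ}
    {E : Finset (Fin m × Fin n)} (hr : 1 ≤ M.rank) {p c κ a g : ℝ} (hp : 0 < p) (hc : 0 ≤ c)
    (hκ : 1 ≤ κ) (ha : 1 ≤ a) (heps : 0 < eps m n #E) (hg : g = √(M.rank / eps m n #E))
    (hcond : sv M 1 ≤ κ * sv M M.rank) (hca : c ≤ a * g * (p * sv M 1))
    (hsmall : 8 * κ ^ 2 * (a + 2) ^ 2 * g < 1)
    (h : ∀ x, ‖Matrix.toEuclideanLin (trimmed M E - p • M) x‖ ≤ c * ‖x‖) :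
    EstimatesRank M E := by
  set r := M.rank with hrdef
  set σ := sv (trimmed M E) with hσ
  set W := p * sv M 1 with hW
  have hW0 : 0 < W := mul_pos hp (sv_pos le_rfl hr)
  have hr0 : (0 : ℝ) < r := by exact_mod_cast hr
  have hg0 : 0 < g := by rw [hg]; positivity
  have hκ0 : 0 < κ := by linarith
  -- consequences of the smallness of `g`
  have s1 : 4 * κ * a * g ≤ 1 := by
    refine le_trans ?_ hsmall.le
    gcongr
    · norm_num
    · nlinarith
    · nlinarith
  have s2 : 8 * κ ^ 2 * (a + 2) * g < 1 := by
    refine lt_of_le_of_lt ?_ hsmall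
    gcongr
    nlinarith
  have s3 : 4 * κ * (a + 2) * a * g < 1 := by
    refine lt_of_le_of_lt (mul_le_mul_of_nonneg_right ?_ hg0.le) hsmall
    have h1 : (a + 2) * a ≤ (a + 2) ^ 2 := by nlinarith
    have h2 : 4 * κ ≤ 8 * κ ^ 2 := by nlinarith
    calc 4 * κ * (a + 2) * a = 4 * κ * ((a + 2) * a) := by ring
      _ ≤ _ := by gcongr
  have hcW : c ≤ W / (4 * κ) := by
    refine hca.trans ?_
    rw [le_div_iff₀ (by positivity)]
    nlinarith
  have hWκ : W / (4 * κ) ≤ W / 4 := by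
    gcongr; linarith
  have hσ1_le : σ 1 ≤ 2 * W := by
    have := sv_trimmed_le hp hc h 1
    linarith
  have hσ1_ge : W / 2 ≤ σ 1 := by
    have := mul_sv_le_sv_trimmed hp hc h 1
    linarith
  have hσr : W / (2 * κ) ≤ σ r := by
    have h1 := mul_sv_le_sv_trimmed hp hc h r
    have h2 : W / κ ≤ p * sv M r := by
      rw [div_le_iff₀ hκ0, hW]
      calc p * sv M 1 ≤ p * (κ * sv M r) := by gcongr
        _ = _ := by ring
    have h3 : W / κ = W / (2 * κ) + W / (4 * κ) + W / (4 * κ) := by field_simp; norm_num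
    have h4 : 0 ≤ W / (4 * κ) := by positivity
    linarith
  have hσr0 : 0 < σ r := lt_of_lt_of_le (by positivity) hσr
  have hσr1 : σ (r + 1) ≤ a * g * W := by
    have h1 := sv_trimmed_le hp hc h (r + 1)
    rw [hrdef, sv_rank_add_one, mul_zero, zero_add] at h1
    exact h1.trans hca
  -- Numerator at most `(a + 2) g W`, denominator at least `W/(2κ)`.
  have hcostr : cost M E r ≤ ENNReal.ofReal (2 * κ * (a + 2) * g) := by
    rw [cost, ← ENNReal.ofReal_div_of_pos hσr0]
    refine ENNReal.ofReal_le_ofReal ?_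
    rw [div_le_iff₀ hσr0, ← hg]
    calc σ (r + 1) + σ 1 * g ≤ a * g * W + 2 * W * g := by gcongr
      _ = 2 * κ * (a + 2) * g * (W / (2 * κ)) := by field_simp
      _ ≤ _ := by gcongr
  have hlt : ∀ j ∈ Icc 1 (min m n), j ≠ r → cost M E r < cost M E j := by
    intro j hj hjr
    refine lt_of_le_of_lt hcostr ?_
    have hnum : 0 ≤ σ 1 * √((j : ℝ) / eps m n #E) :=
      mul_nonneg (sv_nonneg _ _) (Real.sqrt_nonneg _)
    -- Below the rank the cost is at least `1/(4κ)`, from `σ_{j+1} ≥ W/(2κ)` and `σ_j ≤ 2W`. Above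
    -- it the cost is at least `1/(2a)`, or infinite if `σ_j = 0`.
    rcases lt_or_gt_of_ne hjr with hlt | hgt
    · have hσj : 0 < σ j := hσr0.trans_le (sv_anti _ hlt.le)
      rw [cost, ← ENNReal.ofReal_div_of_pos hσj]
      have h1 : 2 * κ * (a + 2) * g <
          (σ (j + 1) + σ 1 * √((j : ℝ) / eps m n #E)) / σ j := by
        rw [lt_div_iff₀ hσj]
        calc 2 * κ * (a + 2) * g * σ j ≤ 2 * κ * (a + 2) * g * (2 * W) := by
              gcongr
              exact (sv_anti _ (mem_Icc.mp hj).1).trans hσ1_le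
          _ = (8 * κ ^ 2 * (a + 2) * g) * (W / (2 * κ)) := by field_simp; ring
          _ < 1 * (W / (2 * κ)) := by gcongr
          _ ≤ σ (j + 1) := by rw [one_mul]; exact hσr.trans (sv_anti _ hlt)
          _ ≤ _ := by linarith
      exact (ENNReal.ofReal_lt_ofReal_iff_of_nonneg (by positivity)).mpr h1
    · have hgj : g ≤ √((j : ℝ) / eps m n #E) := by
        rw [hg]
        gcongr
      have hN : W / 2 * g ≤ σ (j + 1) + σ 1 * √((j : ℝ) / eps m n #E) := by
        have h1 : W / 2 * g ≤ σ 1 * √((j : ℝ) / eps m n #E) :=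
          mul_le_mul hσ1_ge hgj hg0.le (sv_nonneg _ _)
        have h2 : 0 ≤ σ (j + 1) := sv_nonneg _ _
        linarith
      have hN0 : 0 < σ (j + 1) + σ 1 * √((j : ℝ) / eps m n #E) :=
        lt_of_lt_of_le (by positivity) hN
      rcases (sv_nonneg (trimmed M E) j).eq_or_lt with h0 | hσj
      · rw [cost, ← h0, ENNReal.ofReal_zero, ENNReal.div_zero (by simpa using hN0)]
        exact ENNReal.ofReal_lt_top
      · rw [cost, ← ENNReal.ofReal_div_of_pos hσj]
        refine (ENNReal.ofReal_lt_ofReal_iff_of_nonneg (by positivity)).mpr ?_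
        rw [lt_div_iff₀ hσj]
        refine lt_of_lt_of_le ?_ hN
        calc 2 * κ * (a + 2) * g * σ j ≤ 2 * κ * (a + 2) * g * (a * g * W) := by
              gcongr
              exact (sv_anti _ hgt).trans hσr1
          _ = (4 * κ * (a + 2) * a * g) * (W / 2 * g) := by ring
          _ < 1 * (W / 2 * g) := by gcongr
          _ = _ := one_mul _
  have hrmem : r ∈ Icc 1 (min m n) := by
    refine mem_Icc.mpr ⟨hr, le_min ?_ ?_⟩
    · simpa using M.rank_le_card_height
    · simpa using M.rank_le_card_width
  intro i
  constructor
  · rintro ⟨hi, hmin⟩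
    by_contra hne
    exact absurd (hmin r hrmem) (not_le.mpr (hlt i hi hne))
  · rintro rfl
    refine ⟨hrmem, fun j hj => ?_⟩
    rcases eq_or_ne j r with rfl | hne
    · exact le_rfl
    · exact (hlt j hj hne).le

theorem abs_le_maxEntry (M : Matrix (Fin m) (Fin n) ℝ) (i : Fin m) (j : Fin n) :
    |M i j| ≤ maxEntry M :=
  le_ciSup (f := fun p : Fin m × Fin n => |M p.1 p.2|) (Set.finite_range _).bddAbove (i, j)

theorem maxEntry_pos {M : Matrix (Fin m) (Fin n) ℝ} (hr : 1 ≤ M.rank) : 0 < maxEntry M := by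
  by_contra! h
  have : M = 0 := by
    ext i j
    exact abs_nonpos_iff.mp ((abs_le_maxEntry M i j).trans h)
  rw [this, Matrix.rank_zero] at hr
  lia

theorem sqrt_aspectRatio (hm : 0 < m) (hn : 0 < n) :
    √(aspectRatio m n) = ((max m n : ℕ) : ℝ) / √((m : ℝ) * n) := by
  have hm0 : (0 : ℝ) < m := by exact_mod_cast hm
  have hn0 : (0 : ℝ) < n := by exact_mod_cast hn
  have hmin : (0 : ℝ) < min (m : ℝ) n := lt_min hm0 hn0
  have hmax : (0 : ℝ) < max (m : ℝ) n := lt_max_of_lt_left hm0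
  have h : aspectRatio m n = (max (m : ℝ) n) ^ 2 / ((m : ℝ) * n) := by
    rw [aspectRatio, ← min_mul_max (m : ℝ) n]
    field_simp
  rw [h, Real.sqrt_div (by positivity), Real.sqrt_sq hmax.le, Nat.cast_max]

theorem one_le_aspectRatio (hm : 0 < m) (hn : 0 < n) : 1 ≤ aspectRatio m n := by
  have hmin : (0 : ℝ) < min (m : ℝ) n := lt_min (by exact_mod_cast hm) (by exact_mod_cast hn)
  rw [aspectRatio, one_le_div hmin]
  exact min_le_max

/-- The deviation bound for the trimmed matrix, in terms of `ξ`. -/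
theorem maxEntry_mul_sqrt_le {M : Matrix (Fin m) (Fin n) ℝ} (hm : 0 < m) (hn : 0 < n)
    (hr : 1 ≤ M.rank) {ξ : ℝ} (hξ : spikeParameter M ≤ ξ) {s : ℕ} (hs : 0 < eps m n s) :
    maxEntry M * √((s : ℝ) / (m * n) * (max m n : ℕ)) ≤
      ξ * √(M.rank / eps m n s) * ((s : ℝ) / (m * n) * sv M 1) := by
  have hm0 : (0 : ℝ) < m := by exact_mod_cast hm
  have hn0 : (0 : ℝ) < n := by exact_mod_cast hn
  have hr0 : (0 : ℝ) < M.rank := by exact_mod_cast hr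
  have hS : 0 < sv M 1 := sv_pos le_rfl hr
  have hmn : 0 < √((m : ℝ) * n) := by positivity
  have hb := maxEntry_pos hr
  have hα := one_le_aspectRatio hm hn
  have hsq : √((m : ℝ) * n) * √((m : ℝ) * n) = m * n := Real.mul_self_sqrt (by positivity)
  have hp : (s : ℝ) / (m * n) = eps m n s / √((m : ℝ) * n) := by
    rw [eps, div_div, hsq]
  have h1 : (s : ℝ) / (m * n) * (max m n : ℕ) = eps m n s * √(aspectRatio m n) := by
    rw [sqrt_aspectRatio hm hn, hp]; ring
  have h2 : maxEntry M * √(aspectRatio m n) ≤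
      ξ * (sv M 1 / √((m : ℝ) * n) * √(M.rank : ℝ)) := by
    rw [spikeParameter, div_le_iff₀ (by positivity)] at hξ
    exact hξ
  -- In fact `p L = ε √α`; weakening this to `ε α` produces exactly the factor `√α` contained in
  -- `ξ`.
  have h3 : √(aspectRatio m n) ≤ aspectRatio m n := by
    refine Real.sqrt_le_iff.mpr ⟨by linarith, ?_⟩
    nlinarith
  calc maxEntry M * √((s : ℝ) / (m * n) * (max m n : ℕ))
      ≤ maxEntry M * √(eps m n s * aspectRatio m n) := by rw [h1]; gcongr
    _ = maxEntry M * √(aspectRatio m n) * √(eps m n s) := by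
        rw [Real.sqrt_mul hs.le]; ring
    _ ≤ ξ * (sv M 1 / √((m : ℝ) * n) * √(M.rank : ℝ)) * √(eps m n s) := by gcongr
    _ = _ := by
        rw [hp, Real.sqrt_div hr0.le]
        have h4 : eps m n s = √(eps m n s) * √(eps m n s) := (Real.mul_self_sqrt hs.le).symm
        have h5 : 0 < √(eps m n s) := Real.sqrt_pos.mpr hs
        generalize √(eps m n s) = q at *
        rw [h4]
        field_simp

end RankEstimation

theorem proposition1 (κ ξ : ℝ) :
    ∃ C : ℝ, 0 < C ∧ ∀ δ : ℝ, 0 < δ → ∃ N : ℕ,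
      ∀ (m n r s : ℕ) (M : Matrix (Fin m) (Fin n) ℝ),
        N ≤ m → N ≤ n → M.rank = r → 1 ≤ r →
        RankEstimation.conditionNumber M ≤ κ →
        RankEstimation.spikeParameter M ≤ ξ →
        s ≤ m * n →
        RankEstimation.eps m n s > C * r →
        RankEstimation.uniformProb m n s (fun E => RankEstimation.EstimatesRank M E) ≥ 1 - δ := by
  open RankEstimation in
  set κ' := max κ 1 with hκ'
  set a := 5330 * max ξ 1 with ha'
  have hκ1 : 1 ≤ κ' := le_max_right _ _
  have hξ1 : 1 ≤ max ξ 1 := le_max_right _ _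
  have ha1 : 1 ≤ a := by linarith
  set Z := 8 * κ' ^ 2 * (a + 2) ^ 2 with hZ
  have hZ8 : 8 ≤ Z := by
    have h1 : 1 ≤ κ' ^ 2 := one_le_pow₀ hκ1
    have h2 : 1 ≤ (a + 2) ^ 2 := one_le_pow₀ (by linarith)
    nlinarith
  -- `ε > Z² r` says precisely that `Z g < 1`, the smallness needed for the comparison of costs. `N`
  -- makes the failure probability `6/L` at most `δ`, and the `+ 1` makes `m` and `n` positive.
  refine ⟨Z ^ 2, by positivity, fun δ hδ => ⟨⌈6 / δ⌉₊ + 1, ?_⟩⟩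
  rintro m n r s M hNm hNn rfl hr hκ hξ hs heps
  have hm : 0 < m := by lia
  have hn : 0 < n := by lia
  have hr1 : (1 : ℝ) ≤ M.rank := by exact_mod_cast hr
  have hm0 : (0 : ℝ) < m := by exact_mod_cast hm
  have hn0 : (0 : ℝ) < n := by exact_mod_cast hn
  have heps64 : 64 < eps m n s := by nlinarith
  have heps0 : 0 < eps m n s := by linarith
  have hmn : 0 < √((m : ℝ) * n) := by positivity
  have hs0 : (0 : ℝ) < s := by
    rw [eps] at heps0
    by_contra h
    have : (s : ℝ) = 0 := le_antisymm (not_lt.mp h) (Nat.cast_nonneg s)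
    simp [this] at heps0
  have hp0 : 0 < (s : ℝ) / (m * n) := by positivity
  have hpL : (s : ℝ) / (m * n) * (max m n : ℕ) = eps m n s * √(aspectRatio m n) := by
    rw [sqrt_aspectRatio hm hn, eps]
    have hsq : √((m : ℝ) * n) * √((m : ℝ) * n) = m * n := Real.mul_self_sqrt (by positivity)
    rw [div_mul_div_comm, hsq]; ring
  -- This is `D ≥ 4`; it follows from `p L = ε √α` and `ε > 64`.
  have hd : 16 ≤ (s : ℝ) / (m * n) * (max m n : ℕ) := by
    rw [hpL]
    have : 1 ≤ √(aspectRatio m n) := Real.one_le_sqrt.mpr (one_le_aspectRatio hm hn)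
    nlinarith
  have hprob := uniformProb_norm_trimmed_sub_ge hs hm hn rfl rfl hd M (maxEntry_pos hr)
    (abs_le_maxEntry M)
  have hδL : 6 / ((max m n : ℕ) : ℝ) ≤ δ := by
    have h1 : 6 / δ ≤ ((max m n : ℕ) : ℝ) := by
      refine (Nat.le_ceil _).trans ?_
      exact_mod_cast (show ⌈6 / δ⌉₊ ≤ max m n from le_max_of_le_left (by lia))
    rw [div_le_iff₀ (by positivity)]
    rwa [div_le_iff₀' hδ] at h1
  refine ge_iff_le.mpr (le_trans (by linarith) (hprob.trans (uniformProb_mono fun E hE h => ?_)))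
  subst hE
  have hcond : sv M 1 ≤ κ' * sv M M.rank := by
    rw [← div_le_iff₀ (sv_pos hr le_rfl)]
    exact hκ.trans (le_max_left _ _)
  refine estimatesRank_of_norm_sub_le hr hp0 (by positivity [maxEntry_pos hr]) hκ1 ha1 heps0 rfl
    hcond ?_ ?_ h
  · have := maxEntry_mul_sqrt_le hm hn hr (hξ.trans (le_max_left ξ 1)) heps0
    rw [ha']
    linarith
  · rw [← hZ, ← lt_div_iff₀' (by linarith), Real.sqrt_lt' (by positivity), div_pow, one_pow,
      div_lt_div_iff₀ heps0 (by positivity)]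
    linarith
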